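/- Let $b,m\in\mathbb Z$. For an odd prime $p\nmid bm(b^2+4m^2)$ let $\left(\frac{\cdot}{p}\right)$ be the Legendre symbol, and let $\left(\frac{b+2mi}{p}\right)_4$ be the quartic Jacobi symbol, that is, the product of $\left(\frac{b+2mi}{\pi}\right)_4$ over the prime factors $\pi$ of $p$ in $\mathbb Z[i]$ (with multiplicity), where $\left(\frac{\alpha}{\pi}\right)_4\in\{1,i,-1,-i\}$ is determined, for $\pi\nmid\alpha$, by $\left(\frac{\alpha}{\pi}\right)_4\equiv\alpha^{(N\pi-1)/4}\pmod\pi$, with $N\pi$ the norm of $\pi$. Congruences modulo $p$ between rational numbers with denominators prime to $p$ are understood in the ring of such rationals. For every such $p$ put $$\delta_p=\begin{cases}\left(\frac{b+2mi}{p}\right)_4&\text{if }\left(\frac{b^2+4m^2}{p}\right)=1,\\[2pt] \left(\frac{b+2mi}{p}\right)_4\, i&\text{if }\left(\frac{b^2+4m^2}{p}\right)=-1.\end{cases}$$ Then $\delta_p\in\{1,-1\}$, $$\left(\frac bp\right)\sum_{k=0}^{[p/4]}\binom{4k}{2k}\left(-\frac{m^2}{4b^2}\right)^k\equiv\begin{cases}\delta_p(b^2+4m^2)^{\frac{p-1}4}\pmod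 p&\text{if }4\mid p-1,\ \left(\frac{b^2+4m^2}{p}\right)=1,\\ b\,\delta_p(b^2+4m^2)^{\frac{p-3}4}\pmod p&\text{if }4\mid p-3,\ \left(\frac{b^2+4m^2}{p}\right)=1,\\ 0\pmod p&\text{if }4\mid p-1,\ \left(\frac{b^2+4m^2}{p}\right)=-1,\\ 2m\,\delta_p(b^2+4m^2)^{\frac{p-3}4}\pmod p&\text{if }4\mid p-3,\ \left(\frac{b^2+4m^2}{p}\right)=-1,\end{cases}$$ and $$\left(\frac mp\right)\sum_{k=0}^{[p/4]}\binom{4k}{2k}\left(-\frac{b^2}{64m^2}\right)^k\equiv\begin{cases}\delta_p(b^2+4m^2)^{\frac{p-1}4}\pmod p&\text{if }4\mid p-1,\ \left(\frac{b^2+4m^2}{p}\right)=1,\\ 2m\,\delta_p(b^2+4m^2)^{\frac{p-3}4}\pmod p&\text{if }4\mid p-3,\ \left(\frac{b^2+4m^2}{p}\right)=1,\\ 0\pmod p&\text{if }4\mid p-1,\ \left(\frac{b^2+4m^2}{p}\right)=-1,\\ -b\,\delta_p(b^2+4m^2)^{\frac{p-3}4}\pmod p&\text{if }4\mid p-3,\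 \left(\frac{b^2+4m^2}{p}\right)=-1.\end{cases}$$ Unless $4\mid p-1$ and $\left(\frac{b^2+4m^2}{p}\right)=-1$ (when both sums are $\equiv 0$ and $\delta_p$ does not occur), $\delta_p$ is the unique element of $\{1,-1\}$ satisfying these congruences. Moreover, if $p'$ is also an odd prime with $p'\nmid bm(b^2+4m^2)$ and $p'\equiv\pm p\pmod{(3-(-1)^b)(b^2+4m^2)}$, then $\delta_p=\delta_{p'}$. -/

import Mathlib

namespace QuarticSums

/-- The imaginary unit of `ℤ[i]`. -/
def gI : GaussianInt := ⟨0, 1⟩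

open Classical in
/-- The quartic residue symbol `(α/π)₄` for a Gaussian prime `π` not associated to `1 + i`:
the element of `{1, i, -1, -i}` congruent to `α ^ ((N π - 1) / 4)` modulo `π`, and `0` if `π ∣ α`
(in that case none of the four congruences below holds). -/
noncomputable def quarticResidueSymbol (α π : GaussianInt) : GaussianInt :=
  if π ∣ α ^ ((π.norm.natAbs - 1) / 4) - 1 then 1
  else if π ∣ α ^ ((π.norm.natAbs - 1) / 4) - gI then gI
  else if π ∣ α ^ ((π.norm.natAbs - 1) / 4) - (-1) then -1
  else if π ∣ α ^ ((π.norm.natAbs - 1) / 4) - (-gI) then -gI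
  else 0

/-- The quartic Jacobi symbol `(α/β)₄` for `β` prime to `1 + i`: the product of the quartic residue
symbols `(α/π)₄` over the Gaussian prime factors `π` of `β`, with multiplicity. (Each factor is
unique up to a unit, and the residue symbol does not change when `π` is multiplied by a unit.) -/
noncomputable def quarticJacobiSymbol (α β : GaussianInt) : GaussianInt :=
  ((UniqueFactorizationMonoid.factors β).map (quarticResidueSymbol α)).prod

/-- `∑_{k=0}^{[p/4]} C(4k, 2k) x^k` in the field of residues modulo `p`. -/
def binomSum (p : ℕ) (x : ZMod p) : ZMod p :=
  ∑ k ∈ Finset.range (p / 4 + 1), ((4 * k).choose (2 * k) : ZMod p) * x ^ k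

/-- The two systems of congruences modulo `p`, for a given sign `δ`. -/
def SumCongruences (b m : ℤ) (p : ℕ) [Fact p.Prime] (δ : ℤ) : Prop :=
  let S₁ : ZMod p := (legendreSym p b : ZMod p) *
    binomSum p (-((m : ZMod p) ^ 2 / (4 * (b : ZMod p) ^ 2)))
  let S₂ : ZMod p := (legendreSym p m : ZMod p) *
    binomSum p (-((b : ZMod p) ^ 2 / (64 * (m : ZMod p) ^ 2)))
  let D : ℤ := b ^ 2 + 4 * m ^ 2
  (p % 4 = 1 → legendreSym p D = 1 →
      S₁ = ((δ * D ^ ((p - 1) / 4) : ℤ) : ZMod p) ∧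
      S₂ = ((δ * D ^ ((p - 1) / 4) : ℤ) : ZMod p)) ∧
  (p % 4 = 3 → legendreSym p D = 1 →
      S₁ = ((b * δ * D ^ ((p - 3) / 4) : ℤ) : ZMod p) ∧
      S₂ = ((2 * m * δ * D ^ ((p - 3) / 4) : ℤ) : ZMod p)) ∧
  (p % 4 = 1 → legendreSym p D = -1 → S₁ = 0 ∧ S₂ = 0) ∧
  (p % 4 = 3 → legendreSym p D = -1 →
      S₁ = ((2 * m * δ * D ^ ((p - 3) / 4) : ℤ) : ZMod p) ∧
      S₂ = ((-b * δ * D ^ ((p - 3) / 4) : ℤ) : ZMod p))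

end QuarticSums

/-! ### Units, norms and conjugation in `ℤ[i]` -/

namespace QuarticSums

/-! Put α = b + 2mi with conjugate ᾱ and norm N, and p* = ±p ≡ 1 (mod 4). Symbols and sums are
compared in a field of characteristic p that receives a homomorphism from `ℤ[i]`; units stay
distinct there.

Congruences. In characteristic p the integer (p-1)/2 is -1/2, so C(4k,2k) = 16^k C((p-1)/2, 2k), and
each sum is half of (1+y)^((p-1)/2) + (1-y)^((p-1)/2) with y² = 16x (`two_mul_binomSum`). The
Legendre factor turns this into a combination of α^((p-1)/2) and ᾱ^((p-1)/2). Frobenius acts on the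
image of `ℤ[i]` as the identity or as conjugation, whence (α/p)₄ = (α/ᾱ)^((p*-1)/4)
(`hom_quarticJacobiSymbol`). This expresses both powers through the symbol and a power of N
(`hom_pow_half_of_one`, `hom_pow_half_of_three`). The square of the symbol is the Legendre symbol of
N (`hom_symbol_sq`), so δ is a sign.

Periodicity. For a primary prime π of prime norm q, quartic reciprocity says (π/p)₄ = χ(p*) with χ
the quartic character modulo π (`quarticJacobiSymbol_eq_char`). It follows from G(χ)⁴ = π³π̄, a
consequence of J(χ,χ²) = -π, by raising the Gauss sum to the power p. Units, integers and powers of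
1 + i are unit multiples of their conjugates, so their symbols are explicit. Factoring α then shows
that its symbol depends only on p* modulo the stated modulus, and p' ≡ ±p forces p'* ≡ p*. -/

theorem gI_mul_gI : gI * gI = -1 := by decide

theorem star_gI : star gI = -gI := by decide

theorem norm_eq (z : GaussianInt) : z.norm = z.re ^ 2 + z.im ^ 2 := by
  rw [Zsqrtd.norm_def]; ring

theorem isUnit_iff {z : GaussianInt} :
    IsUnit z ↔ z = 1 ∨ z = gI ∨ z = -1 ∨ z = -gI := by
  constructor
  · intro h
    have h1 := (Zsqrtd.norm_eq_one_iff' (by norm_num) z).2 h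
    rw [norm_eq] at h1
    obtain ⟨x, y⟩ := z
    simp only at h1
    have hx : x ≤ 1 := by nlinarith
    have hx' : -1 ≤ x := by nlinarith
    have hy : y ≤ 1 := by nlinarith
    have hy' : -1 ≤ y := by nlinarith
    interval_cases x <;> interval_cases y <;> first | omega | decide
  · have hI : IsUnit gI := IsUnit.of_mul_eq_one (-gI) (by rw [mul_neg, gI_mul_gI, neg_neg])
    rintro (rfl | rfl | rfl | rfl)
    exacts [isUnit_one, hI, isUnit_one.neg, hI.neg]

theorem isUnit_gI : IsUnit gI := isUnit_iff.2 (by simp)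

theorem mul_star_eq_one {z : GaussianInt} (h : IsUnit z) : z * star z = 1 := by
  rw [← Zsqrtd.norm_eq_mul_conj, (Zsqrtd.norm_eq_one_iff' (by norm_num) z).2 h, Int.cast_one]

theorem norm_star (z : GaussianInt) : (star z).norm = z.norm := by
  simp [norm_eq]

theorem star_pow_sub (z w : GaussianInt) (n : ℕ) : star (z ^ n - w) = star z ^ n - star w := by
  rw [star_sub, star_pow]

theorem intCast_pow_char {R : Type*} [CommRing R] {p : ℕ} [Fact p.Prime] [CharP R p] (n : ℤ) :
    (n : R) ^ p = n := by
  have := congrArg (ZMod.castHom (dvd_refl p) R) (ZMod.pow_card (n : ZMod p))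
  rwa [map_pow, map_intCast] at this

/-! ### Homomorphisms from `ℤ[i]` to fields, and Frobenius -/

section Hom

variable {R : Type*} [Field R] (φ : GaussianInt →+* R)

theorem hom_gI_sq : φ gI * φ gI = -1 := by
  rw [← map_mul, gI_mul_gI, map_neg, map_one]

theorem hom_apply (z : GaussianInt) : φ z = z.re + φ gI * z.im := by
  have h : z = (z.re : GaussianInt) + gI * (z.im : GaussianInt) := by
    ext <;> simp [gI]
  conv_lhs => rw [h]
  simp

theorem hom_star (z : GaussianInt) : φ (star z) = z.re - φ gI * z.im := by
  rw [hom_apply]; simp [sub_eq_add_neg]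

theorem hom_mul_star (z : GaussianInt) : φ z * φ (star z) = (z.norm : R) := by
  rw [← map_mul, ← Zsqrtd.norm_eq_mul_conj, map_intCast]

theorem hom_gI_ne_zero : φ gI ≠ 0 := (isUnit_gI.map φ).ne_zero

/-- Lets an identity between symbols, which are units, be checked after applying `φ`. -/
theorem hom_injOn_units (h2 : (2 : R) ≠ 0) {s t : GaussianInt} (hs : IsUnit s) (ht : IsUnit t)
    (h : φ s = φ t) : s = t := by
  have hi := hom_gI_sq φ
  have h11 : (1 : R) ≠ -1 := fun h => h2 (by linear_combination h)
  have h1i : (1 : R) ≠ φ gI := fun h => h11 (by linear_combination (1 + φ gI) * h + hi)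
  have h1i' : (1 : R) ≠ -φ gI := fun h => h11 (by linear_combination (1 - φ gI) * h + hi)
  have hii : φ gI ≠ -φ gI := fun h =>
    (mul_ne_zero h2 (hom_gI_ne_zero φ)) (by linear_combination h)
  rcases isUnit_iff.1 hs with rfl | rfl | rfl | rfl <;>
    rcases isUnit_iff.1 ht with rfl | rfl | rfl | rfl <;>
    simp only [map_neg, map_one, neg_inj] at h ⊢ <;>
    first
      | rfl
      | exact absurd h h11 | exact absurd h.symm h11
      | exact absurd h h1i | exact absurd h.symm h1i
      | exact absurd h h1i' | exact absurd h.symm h1i'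
      | exact absurd h hii | exact absurd h.symm hii
      | exact absurd (by linear_combination -h) h1i
      | exact absurd (by linear_combination -h) h1i'
      | exact absurd (by linear_combination h) h1i
      | exact absurd (by linear_combination h) h1i'

variable {p : ℕ} [CharP R p]

theorem hom_ne_zero {z : GaussianInt} (hz : ¬ (p : ℤ) ∣ z.norm) : φ z ≠ 0 := by
  intro h
  have := hom_mul_star φ z
  rw [h, zero_mul] at this
  exact hz ((CharP.intCast_eq_zero_iff R p _).1 this.symm)

theorem hom_star_ne_zero {z : GaussianInt} (hz : ¬ (p : ℤ) ∣ z.norm) : φ (star z) ≠ 0 :=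
  hom_ne_zero φ (p := p) (by rwa [norm_star])

variable [Fact p.Prime]

/-- Frobenius fixes integers, so it is governed by i^p: it is the identity for p ≡ 1 (mod 4) and
conjugation for p ≡ 3. -/
theorem hom_pow_char (z : GaussianInt) : φ z ^ p = z.re + φ gI ^ p * z.im := by
  have : ExpChar R p := ExpChar.prime Fact.out
  rw [hom_apply φ z, add_pow_expChar, mul_pow, intCast_pow_char, intCast_pow_char]

theorem hom_pow_char_of_one (hp : p % 4 = 1) (z : GaussianInt) : φ z ^ p = φ z := by
  have : φ gI ^ p = φ gI := by
    conv_lhs => rw [← Nat.div_add_mod p 4, hp]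
    rw [pow_add, pow_mul, show φ gI ^ 4 = (φ gI * φ gI) ^ 2 by ring, hom_gI_sq]; simp
  rw [hom_pow_char, this, hom_apply φ z]

theorem hom_pow_char_of_three (hp : p % 4 = 3) (z : GaussianInt) : φ z ^ p = φ (star z) := by
  have : φ gI ^ p = -φ gI := by
    conv_lhs => rw [← Nat.div_add_mod p 4, hp]
    rw [pow_add, pow_mul, show φ gI ^ 4 = (φ gI * φ gI) ^ 2 by ring,
      show φ gI ^ 3 = (φ gI * φ gI) * φ gI by ring, hom_gI_sq]; simp
  rw [hom_pow_char, this, hom_star φ z]; ring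

end Hom

/-- In a field, a fourth root of unity is the image of a unit of `ℤ[i]`. -/
theorem exists_unit_of_pow_four {R : Type*} [Field R] (φ : GaussianInt →+* R) {x : R}
    (hx : x ^ 4 = 1) : ∃ u : GaussianInt, IsUnit u ∧ φ u = x := by
  have hi := hom_gI_sq φ
  have : (x - 1) * (x - φ gI) * ((x + 1) * (x + φ gI)) = 0 := by
    linear_combination hx + (1 - x ^ 2) * hi
  rcases mul_eq_zero.1 this with h | h <;> rcases mul_eq_zero.1 h with h | h
  · exact ⟨1, isUnit_one, by rw [map_one]; linear_combination -h⟩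
  · exact ⟨gI, isUnit_gI, by linear_combination -h⟩
  · exact ⟨-1, isUnit_one.neg, by rw [map_neg, map_one]; linear_combination -h⟩
  · exact ⟨-gI, isUnit_gI.neg, by rw [map_neg]; linear_combination -h⟩

/-! ### The quartic symbols over a rational prime -/

theorem quarticResidueSymbol_spec {α π : GaussianInt}
    (h : ∃ u, IsUnit u ∧ π ∣ α ^ ((π.norm.natAbs - 1) / 4) - u) :
    IsUnit (quarticResidueSymbol α π) ∧
      π ∣ α ^ ((π.norm.natAbs - 1) / 4) - quarticResidueSymbol α π := by
  obtain ⟨u, hu, hd⟩ := h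
  unfold quarticResidueSymbol
  split_ifs with h1 h2 h3 h4
  · exact ⟨isUnit_one, h1⟩
  · exact ⟨isUnit_gI, h2⟩
  · exact ⟨isUnit_one.neg, h3⟩
  · exact ⟨isUnit_gI.neg, h4⟩
  · rcases isUnit_iff.1 hu with rfl | rfl | rfl | rfl <;> contradiction

theorem natAbs_norm_eq_of_associated {π π' : GaussianInt} (h : Associated π π') :
    π.norm.natAbs = π'.norm.natAbs := by
  rw [Zsqrtd.norm_eq_of_associated (by norm_num) h]

theorem quarticResidueSymbol_of_associated (α : GaussianInt) {π π' : GaussianInt}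
    (h : Associated π π') : quarticResidueSymbol α π = quarticResidueSymbol α π' := by
  classical
  have hd : ∀ z, π ∣ z ↔ π' ∣ z := fun z => h.dvd_iff_dvd_left
  unfold quarticResidueSymbol
  rw [natAbs_norm_eq_of_associated h]
  exact if_congr (hd _) rfl <| if_congr (hd _) rfl <| if_congr (hd _) rfl <| if_congr (hd _) rfl rfl

/-- `factors` is an unspecified choice up to associates; since the residue symbol ignores units, any
explicit factorization computes the symbol. -/
theorem quarticJacobiSymbol_eq_prod (α : GaussianInt) {β : GaussianInt} (hβ : β ≠ 0)
    {f : Multiset GaussianInt} (hf : ∀ x ∈ f, Irreducible x) (h : f.prod = β) :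
    quarticJacobiSymbol α β = (f.map (quarticResidueSymbol α)).prod := by
  have hrel := UniqueFactorizationMonoid.factors_unique
    (fun x hx => UniqueFactorizationMonoid.irreducible_of_factor x hx) hf
    ((UniqueFactorizationMonoid.factors_prod hβ).trans (Associated.of_eq h.symm))
  unfold quarticJacobiSymbol
  congr 1
  rw [← Multiset.rel_eq, Multiset.rel_map]
  exact hrel.mono fun a _ b _ hab => quarticResidueSymbol_of_associated α hab

/-- The residue field of a Gaussian prime dividing the rational prime `p` gives a homomorphism to
a field of characteristic `p` whose kernel consists of the multiples of the prime. -/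
theorem exists_hom_of_prime {p : ℕ} [Fact p.Prime] {π : GaussianInt} (hπ : Prime π)
    (hd : π ∣ (p : GaussianInt)) :
    ∃ (R : Type) (_ : Field R) (_ : CharP R p) (φ : GaussianInt →+* R),
      ∀ z, φ z = 0 ↔ π ∣ z := by
  have hmax : (Ideal.span {π}).IsMaximal :=
    PrincipalIdealRing.isMaximal_of_irreducible hπ.irreducible
  let _ : Field (GaussianInt ⧸ Ideal.span {π}) := Ideal.Quotient.field _
  have hker : ∀ z, Ideal.Quotient.mk (Ideal.span {π}) z = 0 ↔ π ∣ z := fun z => by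
    rw [Ideal.Quotient.eq_zero_iff_mem, Ideal.mem_span_singleton]
  have h0 : ((p : ℕ) : GaussianInt ⧸ Ideal.span {π}) = 0 := by
    rw [← map_natCast (Ideal.Quotient.mk (Ideal.span {π}))]
    exact (hker _).2 hd
  exact ⟨_, inferInstance,
    ringChar.of_eq (CharP.ringChar_of_prime_eq_zero Fact.out h0), _, hker⟩

theorem irreducible_of_norm_prime {z : GaussianInt} {q : ℕ} (hq : q.Prime) (hz : z.norm = q) :
    Irreducible z := by
  constructor
  · intro h
    have := (Zsqrtd.norm_eq_one_iff' (by norm_num) z).2 h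
    rw [hz] at this
    exact hq.one_lt.ne' (by exact_mod_cast this)
  · rintro x y rfl
    have h := congrArg Int.natAbs hz
    rw [Zsqrtd.norm_mul, Int.natAbs_mul, Int.natAbs_natCast] at h
    rcases (Nat.prime_mul_iff.1 (h ▸ hq)) with ⟨_, h1⟩ | ⟨_, h1⟩
    · exact Or.inr (Zsqrtd.norm_eq_one_iff.1 h1)
    · exact Or.inl (Zsqrtd.norm_eq_one_iff.1 h1)

/-- The integer `p* = ± p` that is congruent to `1` modulo `4`, for odd `p`. -/
def pstar (p : ℕ) : ℤ := if p % 4 = 1 then p else -p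

theorem mod_four_of_prime {p : ℕ} [hp : Fact p.Prime] (h2 : p ≠ 2) : p % 4 = 1 ∨ p % 4 = 3 := by
  have := hp.out.eq_two_or_odd
  omega

/-- Modulo `l` Frobenius fixes α, so α^((p-1)/4) is a fourth root of unity and lifts to a unit. -/
theorem quarticResidueSymbol_of_norm_eq {p : ℕ} [Fact p.Prime] (hp : p % 4 = 1)
    {α l : GaussianInt} (hl : l.norm = p) (hα : ¬ (p : ℤ) ∣ α.norm) :
    IsUnit (quarticResidueSymbol α l) ∧ l ∣ α ^ ((p - 1) / 4) - quarticResidueSymbol α l := by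
  have hirr := irreducible_of_norm_prime Fact.out hl
  have hld : l ∣ (p : GaussianInt) := ⟨star l, by
    rw [← Zsqrtd.norm_eq_mul_conj, hl, Int.cast_natCast]⟩
  obtain ⟨R, _, _, φ, hφ⟩ := exists_hom_of_prime hirr.prime hld
  have hn : (l.norm.natAbs - 1) / 4 = (p - 1) / 4 := by rw [hl, Int.natAbs_natCast]
  rw [← hn]
  apply quarticResidueSymbol_spec
  rw [hn]
  have h4 : (φ α ^ ((p - 1) / 4)) ^ 4 = 1 := by
    rw [← pow_mul, show (p - 1) / 4 * 4 = p - 1 by omega]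
    have h0 := hom_ne_zero φ (p := p) hα
    apply mul_right_cancel₀ h0
    rw [← pow_succ, show p - 1 + 1 = p by omega, hom_pow_char_of_one φ hp, one_mul]
  obtain ⟨u, hu, h⟩ := exists_unit_of_pow_four φ h4
  exact ⟨u, hu, (hφ _).1 (by rw [map_sub, map_pow, h, sub_self])⟩

/-- Here p is inert with norm p², and (p²-1)/4 = (p-1)·(p+1)/4; applying Frobenius twice is
conjugating twice, so α^(p²-1) = 1. -/
theorem quarticResidueSymbol_of_three {p : ℕ} [Fact p.Prime] (hp : p % 4 = 3)
    {α : GaussianInt} (hα : ¬ (p : ℤ) ∣ α.norm) :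
    IsUnit (quarticResidueSymbol α p) ∧
      (p : GaussianInt) ∣ α ^ ((p - 1) * ((p + 1) / 4)) - quarticResidueSymbol α p := by
  have hpr := GaussianInt.prime_of_nat_prime_of_mod_four_eq_three p hp
  obtain ⟨R, _, _, φ, hφ⟩ := exists_hom_of_prime hpr (dvd_refl _)
  have hn : (((p : GaussianInt).norm).natAbs - 1) / 4 = (p - 1) * ((p + 1) / 4) := by
    have : ((p : GaussianInt).norm).natAbs = p * p := by simp [Zsqrtd.norm_natCast, Int.natAbs_mul]
    rw [this]
    obtain ⟨k, rfl⟩ : ∃ k, p = 4 * k + 3 := ⟨p / 4, by omega⟩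
    rw [show 4 * k + 3 - 1 = 4 * k + 2 by omega, show (4 * k + 3 + 1) / 4 = k + 1 by omega,
      show (4 * k + 3) * (4 * k + 3) - 1 = 4 * ((4 * k + 2) * (k + 1)) by
        rw [Nat.sub_eq_iff_eq_add (by nlinarith)]; ring]
    omega
  rw [← hn]
  apply quarticResidueSymbol_spec
  rw [hn]
  have h4 : (φ α ^ ((p - 1) * ((p + 1) / 4))) ^ 4 = 1 := by
    rw [← pow_mul, mul_assoc, show (p + 1) / 4 * 4 = p + 1 by omega]
    have h0 := hom_ne_zero φ (p := p) hα
    apply mul_right_cancel₀ h0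
    rw [← pow_succ, show (p - 1) * (p + 1) + 1 = p * p by
      obtain ⟨k, rfl⟩ : ∃ k, p = k + 1 := ⟨p - 1, by omega⟩
      simp; ring, pow_mul, hom_pow_char_of_three φ hp, hom_pow_char_of_three φ hp, star_star,
      one_mul]
  obtain ⟨u, hu, h⟩ := exists_unit_of_pow_four φ h4
  exact ⟨u, hu, (hφ _).1 (by rw [map_sub, map_pow, h, sub_self])⟩

theorem hom_natCast_char {R : Type*} [Field R] (φ : GaussianInt →+* R) {p : ℕ} [CharP R p] :
    φ (p : GaussianInt) = 0 := by
  rw [map_natCast, CharP.cast_eq_zero]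

theorem hom_eq_of_dvd_sub {R : Type*} [Field R] (φ : GaussianInt →+* R) {d x y : GaussianInt}
    (hd : φ d = 0) (h : d ∣ x - y) : φ x = φ y := by
  obtain ⟨c, hc⟩ := h
  have := congrArg φ hc
  rw [map_sub, map_mul, hd, zero_mul] at this
  exact sub_eq_zero.1 this

theorem exists_norm_eq_of_mod_four_eq_one {p : ℕ} [Fact p.Prime] (hp : p % 4 = 1) :
    ∃ l : GaussianInt, l.norm = p := by
  obtain ⟨a, b, h⟩ := Nat.Prime.sq_add_sq (p := p) (by omega)
  exact ⟨⟨a, b⟩, by rw [norm_eq]; simpa using congrArg (Nat.cast (R := ℤ)) h⟩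

theorem quarticJacobiSymbol_eq_mul {p : ℕ} [hp : Fact p.Prime] (α : GaussianInt) {l : GaussianInt}
    (hl : l.norm = p) : quarticJacobiSymbol α p =
      quarticResidueSymbol α l * quarticResidueSymbol α (star l) := by
  rw [quarticJacobiSymbol_eq_prod α (β := (p : GaussianInt)) (f := {l, star l})
    (by exact_mod_cast hp.out.ne_zero)]
  · simp
  · intro x hx
    simp only [Multiset.insert_eq_cons, Multiset.mem_cons, Multiset.mem_singleton] at hx
    rcases hx with rfl | rfl
    · exact irreducible_of_norm_prime hp.out hl
    · exact irreducible_of_norm_prime hp.out (by rw [norm_star, hl])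
  · simp [← Zsqrtd.norm_eq_mul_conj, hl]

theorem quarticJacobiSymbol_eq_of_three {p : ℕ} [hp : Fact p.Prime] (h3 : p % 4 = 3)
    (α : GaussianInt) : quarticJacobiSymbol α p = quarticResidueSymbol α p := by
  have hpr := GaussianInt.prime_of_nat_prime_of_mod_four_eq_three p h3
  rw [quarticJacobiSymbol_eq_prod α (β := (p : GaussianInt)) (f := {(p : GaussianInt)})
    hpr.ne_zero (by simpa using hpr.irreducible) (by simp)]
  simp

theorem isUnit_quarticJacobiSymbol {p : ℕ} [Fact p.Prime] (h2 : p ≠ 2) {α : GaussianInt}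
    (hα : ¬ (p : ℤ) ∣ α.norm) : IsUnit (quarticJacobiSymbol α p) := by
  rcases mod_four_of_prime h2 with h | h
  · obtain ⟨l, hl⟩ := exists_norm_eq_of_mod_four_eq_one h
    rw [quarticJacobiSymbol_eq_mul α hl]
    exact (quarticResidueSymbol_of_norm_eq h hl hα).1.mul
      (quarticResidueSymbol_of_norm_eq h (by rw [norm_star, hl]) hα).1
  · rw [quarticJacobiSymbol_eq_of_three h]
    exact (quarticResidueSymbol_of_three h hα).1

/-! ### The symbol as a power of α/ᾱ in characteristic p -/

section Spec

variable {R : Type*} [Field R] (φ : GaussianInt →+* R) {p : ℕ} [Fact p.Prime] [CharP R p]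
  {α : GaussianInt}

theorem hom_symbol_mul_of_one (hp : p % 4 = 1) (hα : ¬ (p : ℤ) ∣ α.norm) :
    φ (quarticJacobiSymbol α p) * φ (star α) ^ ((p - 1) / 4) = φ α ^ ((p - 1) / 4) := by
  obtain ⟨l, hl, hφl⟩ : ∃ l : GaussianInt, l.norm = p ∧ φ l = 0 := by
    obtain ⟨l, hl⟩ := exists_norm_eq_of_mod_four_eq_one hp
    have h0 := hom_mul_star φ l
    rw [hl, Int.cast_natCast, CharP.cast_eq_zero] at h0
    rcases mul_eq_zero.1 h0 with h | h
    · exact ⟨l, hl, h⟩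
    · exact ⟨star l, by rw [norm_star, hl], h⟩
  obtain ⟨-, hd⟩ := quarticResidueSymbol_of_norm_eq hp hl hα
  obtain ⟨hu', hd'⟩ := quarticResidueSymbol_of_norm_eq (l := star l) hp (by rw [norm_star, hl]) hα
  rw [quarticJacobiSymbol_eq_mul α hl]
  have e := hom_eq_of_dvd_sub φ hφl hd
  -- Conjugation moves the congruence modulo the conjugate prime to one modulo `l`. The conjugate of
  -- a unit is its inverse, hence the quotient α/ᾱ.
  have hd'' : l ∣ star α ^ ((p - 1) / 4) - star (quarticResidueSymbol α (star l)) := by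
    obtain ⟨c, hc⟩ := hd'
    exact ⟨star c, by rw [← star_pow_sub, hc, star_mul, star_star, mul_comm]⟩
  have e' := hom_eq_of_dvd_sub φ hφl hd''
  rw [map_pow] at e e'
  rw [e, e', map_mul, mul_assoc, ← map_mul, mul_star_eq_one hu', map_one, mul_one]

/-- Since α^p = ᾱ, the power α^((p-1)(p+1)/4) is (ᾱ/α)^((p+1)/4). -/
theorem hom_symbol_mul_of_three (hp : p % 4 = 3) (hα : ¬ (p : ℤ) ∣ α.norm) :
    φ (quarticJacobiSymbol α p) * φ α ^ ((p + 1) / 4) = φ (star α) ^ ((p + 1) / 4) := by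
  obtain ⟨-, hd⟩ := quarticResidueSymbol_of_three hp hα
  have e := hom_eq_of_dvd_sub φ (hom_natCast_char φ) hd
  rw [quarticJacobiSymbol_eq_of_three hp, ← e, map_pow, ← pow_add, ← hom_pow_char_of_three φ hp,
    ← pow_mul]
  congr 1
  obtain ⟨k, hk⟩ : ∃ k, p = k + 1 := ⟨p - 1, by omega⟩
  simp only [hk, Nat.add_sub_cancel]
  ring

/-- The quartic Jacobi symbol of `α` over `p`, computed in characteristic `p`. -/
theorem hom_quarticJacobiSymbol (h2 : p ≠ 2) (hα : ¬ (p : ℤ) ∣ α.norm) :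
    φ (quarticJacobiSymbol α p) = (φ α / φ (star α)) ^ ((pstar p - 1) / 4) := by
  have h0 := hom_ne_zero φ (p := p) hα
  have h0' := hom_star_ne_zero φ (p := p) hα
  rcases mod_four_of_prime h2 with h | h
  · have e : (pstar p - 1) / 4 = (((p - 1) / 4 : ℕ) : ℤ) := by
      rw [pstar, if_pos h]; omega
    rw [e, zpow_natCast, div_pow, eq_div_iff (pow_ne_zero _ h0'), hom_symbol_mul_of_one φ h hα]
  · have e : (pstar p - 1) / 4 = -(((p + 1) / 4 : ℕ) : ℤ) := by
      rw [pstar, if_neg (by omega)]; omega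
    rw [e, zpow_neg, zpow_natCast, ← inv_pow, inv_div, div_pow, eq_div_iff (pow_ne_zero _ h0),
      hom_symbol_mul_of_three φ h hα]

end Spec

/-- There is a homomorphism from `ℤ[i]` to an algebraically closed field of characteristic `p`. -/
theorem exists_hom_algebraicClosure (p : ℕ) [Fact p.Prime] :
    Nonempty (GaussianInt →+* AlgebraicClosure (ZMod p)) := by
  obtain ⟨r, hr⟩ := IsAlgClosed.exists_pow_nat_eq (-1 : AlgebraicClosure (ZMod p)) (n := 2)
    (by norm_num)
  exact ⟨Zsqrtd.lift ⟨r, by rw [← sq, hr]; simp⟩⟩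

theorem two_ne_zero_of_charP {R : Type*} [Field R] {p : ℕ} [Fact p.Prime] [CharP R p]
    (h2 : p ≠ 2) : (2 : R) ≠ 0 := by
  intro h
  have : ((2 : ℕ) : R) = 0 := by exact_mod_cast h
  rw [CharP.cast_eq_zero_iff R p] at this
  exact h2 ((Nat.prime_dvd_prime_iff_eq Fact.out Nat.prime_two).1 this)

/-- A unit is the symbol as soon as one residue characteristic homomorphism says so. -/
theorem quarticJacobiSymbol_eq_of_hom {R : Type*} [Field R] (φ : GaussianInt →+* R) {p : ℕ}
    [Fact p.Prime] [CharP R p] (h2 : p ≠ 2) {α u : GaussianInt} (hα : ¬ (p : ℤ) ∣ α.norm)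
    (hu : IsUnit u) (h : φ u = (φ α / φ (star α)) ^ ((pstar p - 1) / 4)) :
    quarticJacobiSymbol α p = u :=
  hom_injOn_units φ (two_ne_zero_of_charP (p := p) h2) (isUnit_quarticJacobiSymbol h2 hα) hu
    (by rw [hom_quarticJacobiSymbol φ h2 hα, h])

theorem not_dvd_norm_of_mul {p : ℕ} {α β : GaussianInt} (h : ¬ (p : ℤ) ∣ (α * β).norm) :
    ¬ (p : ℤ) ∣ α.norm ∧ ¬ (p : ℤ) ∣ β.norm := by
  rw [Zsqrtd.norm_mul] at h
  exact ⟨fun h' => h (h'.mul_right _), fun h' => h (h'.mul_left _)⟩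

theorem quarticJacobiSymbol_mul {p : ℕ} [Fact p.Prime] (h2 : p ≠ 2) {α β : GaussianInt}
    (h : ¬ (p : ℤ) ∣ (α * β).norm) :
    quarticJacobiSymbol (α * β) p = quarticJacobiSymbol α p * quarticJacobiSymbol β p := by
  obtain ⟨φ⟩ := exists_hom_algebraicClosure p
  obtain ⟨hα, hβ⟩ := not_dvd_norm_of_mul h
  apply quarticJacobiSymbol_eq_of_hom φ h2 h
  · exact (isUnit_quarticJacobiSymbol h2 hα).mul (isUnit_quarticJacobiSymbol h2 hβ)
  · rw [map_mul, hom_quarticJacobiSymbol φ h2 hα, hom_quarticJacobiSymbol φ h2 hβ, ← mul_zpow,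
      star_mul', map_mul, map_mul, mul_div_mul_comm]

/-! ### The binomial sums in characteristic p -/

theorem sum_range_eq_sum_even {R : Type*} [AddCommMonoid R] (f : ℕ → R)
    (hf : ∀ k, f (2 * k + 1) = 0) (n : ℕ) :
    ∑ j ∈ Finset.range (n + 1), f j = ∑ k ∈ Finset.range (n / 2 + 1), f (2 * k) := by
  induction n with
  | zero => simp
  | succ n ih =>
    rw [Finset.sum_range_succ, ih]
    rcases Nat.even_or_odd' n with ⟨c, rfl | rfl⟩
    · rw [hf, add_zero, show (2 * c + 1) / 2 = 2 * c / 2 by omega]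
    · rw [show (2 * c + 1 + 1) / 2 = (2 * c + 1) / 2 + 1 by omega,
        Finset.sum_range_succ _ ((2 * c + 1) / 2 + 1),
        show 2 * ((2 * c + 1) / 2 + 1) = 2 * c + 1 + 1 by omega]

theorem two_mul_sum_even_choose {R : Type*} [CommRing R] (y : R) (n : ℕ) :
    2 * ∑ k ∈ Finset.range (n / 2 + 1), (n.choose (2 * k) : R) * y ^ (2 * k) =
      (1 + y) ^ n + (1 - y) ^ n := by
  rw [add_comm 1 y, show 1 - y = -y + 1 by ring, add_pow, add_pow, ← Finset.sum_add_distrib,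
    sum_range_eq_sum_even (n := n), Finset.mul_sum]
  · refine Finset.sum_congr rfl fun k _ => ?_
    rw [(even_two_mul k).neg_pow]; ring
  · intro k
    rw [(odd_two_mul_add_one k).neg_pow]; ring

theorem hom_legendreSym {R : Type*} [Field R] {p : ℕ} [Fact p.Prime] (ι : ZMod p →+* R) (a : ℤ) :
    ι (legendreSym p a : ZMod p) = (a : R) ^ (p / 2) := by
  rw [legendreSym.eq_pow, map_pow, map_intCast]

theorem hom_mk {R : Type*} [Field R] (φ : GaussianInt →+* R) (b m : ℤ) :
    φ ⟨b, 2 * m⟩ = b + 2 * m * φ gI ∧ φ (star ⟨b, 2 * m⟩) = b - 2 * m * φ gI := by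
  rw [hom_star, hom_apply φ ⟨b, 2 * m⟩]
  push_cast
  constructor <;> ring

section CharP

variable {R : Type*} [Field R] {p : ℕ} [hp : Fact p.Prime] [CharP R p]

/-- This is C(2j,j) = (-4)^j C(-1/2,j), with `p / 2` = -1/2 in `R`. The bound on `j` keeps the
denominators in the recursion invertible. -/
theorem choose_two_mul_self (h2 : p ≠ 2) {j : ℕ} (hj : j ≤ p / 2) :
    ((2 * j).choose j : R) = ((p / 2).choose j : R) * (-4) ^ j := by
  have hodd := hp.out.eq_two_or_odd
  induction j with
  | zero => simp
  | succ j ih =>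
    have ih := ih (by omega)
    have hj0 : ((j + 1 : ℕ) : R) ≠ 0 := by
      rw [Ne, CharP.cast_eq_zero_iff R p]
      exact Nat.not_dvd_of_pos_of_lt (by omega) (by omega)
    have e1 := congrArg (Nat.cast (R := R)) (Nat.succ_mul_centralBinom_succ j)
    have e2 := congrArg (Nat.cast (R := R)) (Nat.choose_succ_right_eq (p / 2) j)
    rw [Nat.centralBinom_eq_two_mul_choose, Nat.centralBinom_eq_two_mul_choose] at e1
    have e3 : ((2 * (p / 2) + 1 : ℕ) : R) = 0 := by
      rw [show 2 * (p / 2) + 1 = p by omega, CharP.cast_eq_zero]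
    push_cast [Nat.cast_sub (show j ≤ p / 2 by omega)] at e1 e2 e3 hj0
    apply mul_left_cancel₀ hj0
    linear_combination e1 + 2 * (2 * j + 1) * ih + 4 * (-4) ^ j * e2 +
      2 * ((p / 2).choose j : R) * (-4) ^ j * e3

theorem two_mul_binomSum (h2 : p ≠ 2) (ι : ZMod p →+* R) {x : ZMod p} {y : R}
    (hxy : 16 * ι x = y ^ 2) :
    2 * ι (binomSum p x) = (1 + y) ^ (p / 2) + (1 - y) ^ (p / 2) := by
  rw [← two_mul_sum_even_choose, binomSum, map_sum, Nat.div_div_eq_div_mul]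
  congr 1
  refine Finset.sum_congr rfl fun k hk => ?_
  rw [Finset.mem_range] at hk
  rw [map_mul, map_natCast, map_pow, show 4 * k = 2 * (2 * k) by ring,
    choose_two_mul_self h2 (by omega), pow_mul, pow_mul, ← hxy, mul_pow, mul_assoc]
  norm_num

theorem intCast_legendreSym (a : ℤ) : ((legendreSym p a : ℤ) : R) = (a : R) ^ (p / 2) := by
  rw [← hom_legendreSym (ZMod.castHom (dvd_refl p) R), map_intCast]

variable (φ : GaussianInt →+* R)

/-- Because ±2i = (1 ± i)², the power is (1 ± i)^(p-1), which Frobenius evaluates. -/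
theorem two_mul_hom_gI_pow_of_one (hp : p % 4 = 1) :
    (2 * φ gI) ^ (p / 2) = 1 ∧ (-(2 * φ gI)) ^ (p / 2) = 1 := by
  have hi := hom_gI_sq φ
  have h2 : (2 : R) ≠ 0 := two_ne_zero_of_charP (p := p) (by omega)
  have key : ∀ z : GaussianInt, φ z ≠ 0 → (φ z ^ 2) ^ (p / 2) = 1 := fun z hz => by
    apply mul_right_cancel₀ hz
    rw [← pow_mul, ← pow_succ, show 2 * (p / 2) + 1 = p by omega, hom_pow_char_of_one φ hp,
      one_mul]
  constructor
  · have e : 2 * φ gI = φ (1 + gI) ^ 2 := by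
      rw [map_add, map_one]; linear_combination -hi
    have h0 : φ (1 + gI) ≠ 0 := fun h => by
      rw [h] at e; exact mul_ne_zero h2 (hom_gI_ne_zero φ) (by rw [e]; ring)
    rw [e, key _ h0]
  · have e : -(2 * φ gI) = φ (1 - gI) ^ 2 := by
      rw [map_sub, map_one]; linear_combination -hi
    have h0 : φ (1 - gI) ≠ 0 := fun h => by
      rw [h] at e; exact neg_ne_zero.2 (mul_ne_zero h2 (hom_gI_ne_zero φ)) (by rw [e]; ring)
    rw [e, key _ h0]

theorem two_mul_hom_gI_pow_of_three (hp : p % 4 = 3) :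
    (2 * φ gI) ^ (p / 2) = -φ gI ∧ (-(2 * φ gI)) ^ (p / 2) = φ gI := by
  have hi := hom_gI_sq φ
  have h2 : (2 : R) ≠ 0 := two_ne_zero_of_charP (p := p) (by omega)
  have key : ∀ z w : GaussianInt, φ z ≠ 0 → star z = w * z → (φ z ^ 2) ^ (p / 2) = φ w :=
    fun z w hz hw => by
      apply mul_right_cancel₀ hz
      rw [← pow_mul, ← pow_succ, show 2 * (p / 2) + 1 = p by omega, hom_pow_char_of_three φ hp,
        hw, map_mul]
  constructor
  · have e : 2 * φ gI = φ (1 + gI) ^ 2 := by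
      rw [map_add, map_one]; linear_combination -hi
    have h0 : φ (1 + gI) ≠ 0 := fun h => by
      rw [h] at e; exact mul_ne_zero h2 (hom_gI_ne_zero φ) (by rw [e]; ring)
    rw [e, key _ (-gI) h0 (by decide), map_neg]
  · have e : -(2 * φ gI) = φ (1 - gI) ^ 2 := by
      rw [map_sub, map_one]; linear_combination -hi
    have h0 : φ (1 - gI) ≠ 0 := fun h => by
      rw [h] at e; exact neg_ne_zero.2 (mul_ne_zero h2 (hom_gI_ne_zero φ)) (by rw [e]; ring)
    rw [e, key _ gI h0 (by decide)]

variable {b m : ℤ}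

theorem two_mul_first_sum (h2 : p ≠ 2) (ι : ZMod p →+* R) (hb : (b : R) ≠ 0) :
    2 * ι ((legendreSym p b : ZMod p) *
      binomSum p (-((m : ZMod p) ^ 2 / (4 * (b : ZMod p) ^ 2)))) =
      φ ⟨b, 2 * m⟩ ^ (p / 2) + φ (star ⟨b, 2 * m⟩) ^ (p / 2) := by
  have h20 : (2 : R) ≠ 0 := two_ne_zero_of_charP (p := p) h2
  have h40 : (4 : R) ≠ 0 := by rw [show (4 : R) = 2 * 2 by norm_num]; exact mul_ne_zero h20 h20
  have hi := hom_gI_sq φ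
  -- The square root y = 2mi/b is chosen so that b(1 ± y) = b ± 2mi.
  have hxy : 16 * ι (-((m : ZMod p) ^ 2 / (4 * (b : ZMod p) ^ 2))) =
      (2 * m * φ gI / b) ^ 2 := by
    rw [map_neg, map_div₀, map_mul, map_pow, map_pow, map_intCast, map_intCast,
      show ι 4 = 4 from map_ofNat ι 4]
    field_simp
    linear_combination -(16 * m ^ 2 : R) * hi
  rw [map_mul, mul_left_comm, two_mul_binomSum h2 ι hxy, hom_legendreSym, mul_add, ← mul_pow,
    ← mul_pow, (hom_mk φ b m).1, (hom_mk φ b m).2, mul_add, mul_sub, mul_one,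
    mul_div_cancel₀ _ hb]

theorem two_mul_second_sum (h2 : p ≠ 2) (ι : ZMod p →+* R) (hm : (m : R) ≠ 0) :
    2 * ι ((legendreSym p m : ZMod p) *
      binomSum p (-((b : ZMod p) ^ 2 / (64 * (m : ZMod p) ^ 2)))) =
      (2 * φ gI) ^ (p / 2) * φ (star ⟨b, 2 * m⟩) ^ (p / 2) +
        (-(2 * φ gI)) ^ (p / 2) * φ ⟨b, 2 * m⟩ ^ (p / 2) := by
  have h20 : (2 : R) ≠ 0 := two_ne_zero_of_charP (p := p) h2
  have h64 : (64 : R) ≠ 0 := by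
    rw [show (64 : R) = 2 ^ 6 by norm_num]; exact pow_ne_zero _ h20
  have hi := hom_gI_sq φ
  have hxy : 16 * ι (-((b : ZMod p) ^ 2 / (64 * (m : ZMod p) ^ 2))) =
      (b * φ gI / (2 * m)) ^ 2 := by
    rw [map_neg, map_div₀, map_mul, map_pow, map_pow, map_intCast, map_intCast,
      show ι 64 = 64 from map_ofNat ι 64]
    field_simp
    linear_combination -(64 * b ^ 2 : R) * hi
  have h4 : (4 : R) ^ (p / 2) = 1 := by
    have hodd := hp.out.eq_two_or_odd
    have h := intCast_pow_char (R := R) (p := p) 2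
    rw [show (4 : R) = 2 ^ 2 by norm_num, ← pow_mul]
    apply mul_right_cancel₀ h20
    rw [← pow_succ, show 2 * (p / 2) + 1 = p by omega]
    simpa using h
  -- The extra factor 4 is harmless, since 4^((p-1)/2) = 1.
  have e1 : 4 * (m * (1 + b * φ gI / (2 * m))) = 2 * φ gI * (b - 2 * m * φ gI) := by
    field_simp
    linear_combination (8 * m : R) * hi
  have e2 : 4 * (m * (1 - b * φ gI / (2 * m))) = -(2 * φ gI) * (b + 2 * m * φ gI) := by
    field_simp
    linear_combination (8 * m : R) * hi
  rw [map_mul, mul_left_comm, two_mul_binomSum h2 ι hxy, hom_legendreSym, (hom_mk φ b m).1,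
    (hom_mk φ b m).2, ← mul_pow, ← mul_pow, ← e1, ← e2]
  simp only [mul_pow, h4]
  ring

/-- By Euler the Legendre symbol of N is (αᾱ)^((p-1)/2); writing it with the (p∓1)/4-th powers of α
and ᾱ, whose ratio is the symbol, leaves the square of the symbol. This decides between ±1 and ±i.
-/
theorem hom_symbol_sq (h2 : p ≠ 2) {α : GaussianInt} (hα : ¬ (p : ℤ) ∣ α.norm) :
    φ (quarticJacobiSymbol α p) ^ 2 = (legendreSym p α.norm : R) := by
  have h0 := hom_ne_zero φ (p := p) hα
  have h0' := hom_star_ne_zero φ (p := p) hα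
  have hN := hom_mul_star φ α
  have hunit : ((legendreSym p α.norm : ℤ) : R) ^ 2 = 1 := by
    have hz : ((α.norm : ℤ) : ZMod p) ≠ 0 := by rwa [Ne, ZMod.intCast_zmod_eq_zero_iff_dvd]
    rw [← Int.cast_pow, legendreSym.sq_one p hz, Int.cast_one]
  rcases mod_four_of_prime h2 with h | h
  · have hs := hom_symbol_mul_of_one φ h hα
    have hl := intCast_legendreSym (R := R) (p := p) α.norm
    have h1 : (φ α ^ ((p - 1) / 4)) ^ 4 = 1 := by
      apply mul_right_cancel₀ h0
      rw [← pow_mul, ← pow_succ, show (p - 1) / 4 * 4 + 1 = p by omega,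
        hom_pow_char_of_one φ h, one_mul]
    rw [← hN, show p / 2 = (p - 1) / 4 * 2 by omega, pow_mul, mul_pow] at hl
    set s := φ (quarticJacobiSymbol α p)
    set A := φ α ^ ((p - 1) / 4)
    set B := φ (star α) ^ ((p - 1) / 4)
    rw [← mul_one (s ^ 2), ← hunit]
    have : s ^ 2 * (A * B) ^ 2 = 1 := by
      linear_combination h1 + A ^ 2 * (s * B + A) * hs
    rw [← hl] at this
    linear_combination ((legendreSym p α.norm : ℤ) : R) * this
  · have hs := hom_symbol_mul_of_three φ h hα
    have hl := intCast_legendreSym (R := R) (p := p) α.norm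
    have h1 : (φ α ^ ((p + 1) / 4)) ^ 4 = φ α * φ (star α) := by
      rw [← pow_mul, show (p + 1) / 4 * 4 = p + 1 by omega, pow_succ,
        hom_pow_char_of_three φ h, mul_comm]
    have h3 : (φ α * φ (star α)) ^ (p / 2) * (φ α * φ (star α)) =
        (φ α ^ ((p + 1) / 4) * φ (star α) ^ ((p + 1) / 4)) ^ 2 := by
      rw [← pow_succ, ← mul_pow, ← pow_mul]
      congr 1
      omega
    rw [hN, ← hl, ← hN] at h3
    apply mul_right_cancel₀ (mul_ne_zero h0 h0')
    rw [h3, ← h1, ← hs]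
    ring

end CharP

theorem symbol_cases_of_legendreSym {p : ℕ} [Fact p.Prime] (h2 : p ≠ 2) {α : GaussianInt}
    (hα : ¬ (p : ℤ) ∣ α.norm) :
    (legendreSym p α.norm = 1 →
      quarticJacobiSymbol α p = 1 ∨ quarticJacobiSymbol α p = -1) ∧
    (legendreSym p α.norm = -1 →
      quarticJacobiSymbol α p = gI ∨ quarticJacobiSymbol α p = -gI) := by
  obtain ⟨φ⟩ := exists_hom_algebraicClosure p
  have h := hom_symbol_sq φ h2 hα
  have h20 : (2 : AlgebraicClosure (ZMod p)) ≠ 0 := two_ne_zero_of_charP (p := p) h2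
  have hi := hom_gI_sq φ
  constructor <;> intro hl <;> rw [hl] at h <;>
    rcases isUnit_iff.1 (isUnit_quarticJacobiSymbol h2 hα) with e | e | e | e <;>
    simp only [e, map_neg, map_one, Int.cast_one, Int.cast_neg] at h ⊢
  · simp
  · exact absurd (by linear_combination hi - h) h20
  · simp
  · exact absurd (by linear_combination hi - h) h20
  · exact absurd (by linear_combination h) h20
  · simp
  · exact absurd (by linear_combination h) h20
  · simp

theorem norm_mk (b m : ℤ) : Zsqrtd.norm (⟨b, 2 * m⟩ : GaussianInt) = b ^ 2 + 4 * m ^ 2 := by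
  rw [norm_eq]; ring

/-! ### The congruences and the uniqueness of the sign -/

section Congruences

variable {R : Type*} [Field R] (φ : GaussianInt →+* R) {p : ℕ} [Fact p.Prime] [CharP R p]

theorem hom_pow_half_of_one (hp : p % 4 = 1) {α : GaussianInt} (hα : ¬ (p : ℤ) ∣ α.norm) :
    φ α ^ (p / 2) = φ (quarticJacobiSymbol α p) * (α.norm : R) ^ ((p - 1) / 4) ∧
    φ (star α) ^ (p / 2) = φ (star (quarticJacobiSymbol α p)) * (α.norm : R) ^ ((p - 1) / 4) := by
  have hs := hom_symbol_mul_of_one φ hp hα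
  have hu : φ (quarticJacobiSymbol α p) * φ (star (quarticJacobiSymbol α p)) = 1 := by
    rw [← map_mul, mul_star_eq_one (isUnit_quarticJacobiSymbol (by omega) hα), map_one]
  rw [show p / 2 = (p - 1) / 4 + (p - 1) / 4 by omega, pow_add, pow_add, ← hom_mul_star φ, mul_pow]
  constructor
  · linear_combination -φ α ^ ((p - 1) / 4) * hs
  · linear_combination φ (star (quarticJacobiSymbol α p)) * φ (star α) ^ ((p - 1) / 4) * hs -
      φ (star α) ^ ((p - 1) / 4) * φ (star α) ^ ((p - 1) / 4) * hu

theorem hom_pow_half_of_three (hp : p % 4 = 3) {α : GaussianInt} (hα : ¬ (p : ℤ) ∣ α.norm) :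
    φ α ^ (p / 2) =
      φ (star (quarticJacobiSymbol α p)) * (α.norm : R) ^ ((p - 3) / 4) * φ (star α) ∧
    φ (star α) ^ (p / 2) =
      φ (quarticJacobiSymbol α p) * (α.norm : R) ^ ((p - 3) / 4) * φ α := by
  have hs := hom_symbol_mul_of_three φ hp hα
  have hu : φ (quarticJacobiSymbol α p) * φ (star (quarticJacobiSymbol α p)) = 1 := by
    rw [← map_mul, mul_star_eq_one (isUnit_quarticJacobiSymbol (by omega) hα), map_one]
  rw [show p / 2 = (p - 3) / 4 + (p - 3) / 4 + 1 by omega, pow_succ, pow_succ, pow_add, pow_add,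
    ← hom_mul_star φ, mul_pow]
  rw [show (p + 1) / 4 = (p - 3) / 4 + 1 by omega, pow_succ, pow_succ] at hs
  constructor
  · linear_combination φ (star (quarticJacobiSymbol α p)) * φ α ^ ((p - 3) / 4) * hs -
      φ α ^ ((p - 3) / 4) * φ α ^ ((p - 3) / 4) * φ α * hu
  · linear_combination -φ (star α) ^ ((p - 3) / 4) * hs

end Congruences

theorem sumCongruences_of_symbol {b m : ℤ} {p : ℕ} [Fact p.Prime] (h2 : p ≠ 2)
    (hb : ¬ (p : ℤ) ∣ b) (hm : ¬ (p : ℤ) ∣ m) (hD : ¬ (p : ℤ) ∣ b ^ 2 + 4 * m ^ 2) {δ : ℤ}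
    (h₁ : legendreSym p (b ^ 2 + 4 * m ^ 2) = 1 →
      (δ : GaussianInt) = quarticJacobiSymbol ⟨b, 2 * m⟩ p)
    (h₂ : legendreSym p (b ^ 2 + 4 * m ^ 2) = -1 →
      (δ : GaussianInt) = quarticJacobiSymbol ⟨b, 2 * m⟩ p * gI) :
    SumCongruences b m p δ := by
  obtain ⟨φ⟩ := exists_hom_algebraicClosure p
  set ι := algebraMap (ZMod p) (AlgebraicClosure (ZMod p)) with hι
  have hinj : Function.Injective ι := ι.injective
  have h20 : (2 : AlgebraicClosure (ZMod p)) ≠ 0 := two_ne_zero_of_charP (p := p) h2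
  have hb0 : (b : AlgebraicClosure (ZMod p)) ≠ 0 := by rwa [Ne, CharP.intCast_eq_zero_iff _ p]
  have hm0 : (m : AlgebraicClosure (ZMod p)) ≠ 0 := by rwa [Ne, CharP.intCast_eq_zero_iff _ p]
  have hN : ¬ (p : ℤ) ∣ Zsqrtd.norm (⟨b, 2 * m⟩ : GaussianInt) := by rwa [norm_mk]
  have hi := hom_gI_sq φ
  have S1 := two_mul_first_sum (m := m) φ h2 ι hb0
  have S2 := two_mul_second_sum (b := b) φ h2 ι hm0
  obtain ⟨ea, eb⟩ := hom_mk φ b m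
  have hs₁ : legendreSym p (b ^ 2 + 4 * m ^ 2) = 1 →
      φ (quarticJacobiSymbol ⟨b, 2 * m⟩ p) = δ ∧
      φ (star (quarticJacobiSymbol ⟨b, 2 * m⟩ p)) = δ := fun hl => by
    rw [← h₁ hl]; simp
  have hs₂ : legendreSym p (b ^ 2 + 4 * m ^ 2) = -1 →
      φ (quarticJacobiSymbol ⟨b, 2 * m⟩ p) = -φ gI * δ ∧
      φ (star (quarticJacobiSymbol ⟨b, 2 * m⟩ p)) = φ gI * δ := fun hl => by
    -- A purely imaginary symbol cancels against its conjugate when p ≡ 1 (mod 4), which is why both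
    -- sums vanish there.
    have : quarticJacobiSymbol ⟨b, 2 * m⟩ p = -gI * δ := by
      rw [h₂ hl]; linear_combination quarticJacobiSymbol ⟨b, 2 * m⟩ p * gI_mul_gI
    rw [this]; simp [star_gI]
  unfold SumCongruences
  dsimp only
  refine ⟨fun hp hl => ?_, fun hp hl => ?_, fun hp hl => ?_, fun hp hl => ?_⟩
  · obtain ⟨e1, e2⟩ := hom_pow_half_of_one φ hp hN
    obtain ⟨c1, c2⟩ := two_mul_hom_gI_pow_of_one φ hp
    obtain ⟨s1, s2⟩ := hs₁ hl
    rw [norm_mk, s1] at e1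
    rw [norm_mk, s2] at e2
    rw [e1, e2] at S1
    rw [e1, e2, c1, c2] at S2
    push_cast at S1 S2
    constructor <;> apply hinj <;> apply mul_left_cancel₀ h20 <;> rw [map_intCast] <;> push_cast
    · linear_combination S1
    · linear_combination S2
  · obtain ⟨e1, e2⟩ := hom_pow_half_of_three φ hp hN
    obtain ⟨c1, c2⟩ := two_mul_hom_gI_pow_of_three φ hp
    obtain ⟨s1, s2⟩ := hs₁ hl
    rw [norm_mk, s2, eb] at e1
    rw [norm_mk, s1, ea] at e2
    rw [e1, e2] at S1
    rw [e1, e2, c1, c2] at S2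
    push_cast at S1 S2
    constructor <;> apply hinj <;> apply mul_left_cancel₀ h20 <;> rw [map_intCast] <;> push_cast
    · linear_combination S1
    · linear_combination S2 - 4 * m * δ * ((b : AlgebraicClosure (ZMod p)) ^ 2 + 4 * m ^ 2) ^
        ((p - 3) / 4) * hi
  · obtain ⟨e1, e2⟩ := hom_pow_half_of_one φ hp hN
    obtain ⟨c1, c2⟩ := two_mul_hom_gI_pow_of_one φ hp
    obtain ⟨s1, s2⟩ := hs₂ hl
    rw [norm_mk, s1] at e1
    rw [norm_mk, s2] at e2
    rw [e1, e2] at S1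
    rw [e1, e2, c1, c2] at S2
    constructor <;> apply hinj <;> apply mul_left_cancel₀ h20 <;> rw [map_zero]
    · linear_combination S1
    · linear_combination S2
  · obtain ⟨e1, e2⟩ := hom_pow_half_of_three φ hp hN
    obtain ⟨c1, c2⟩ := two_mul_hom_gI_pow_of_three φ hp
    obtain ⟨s1, s2⟩ := hs₂ hl
    rw [norm_mk, s2, eb] at e1
    rw [norm_mk, s1, ea] at e2
    rw [e1, e2] at S1
    rw [e1, e2, c1, c2] at S2
    push_cast at S1 S2
    constructor <;> apply hinj <;> apply mul_left_cancel₀ h20 <;> rw [map_intCast] <;> push_cast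
    · linear_combination S1 - 4 * m * δ * ((b : AlgebraicClosure (ZMod p)) ^ 2 + 4 * m ^ 2) ^
        ((p - 3) / 4) * hi
    · linear_combination S2 + 2 * b * δ * ((b : AlgebraicClosure (ZMod p)) ^ 2 + 4 * m ^ 2) ^
        ((p - 3) / 4) * hi

theorem eq_of_intCast_mul_eq {p : ℕ} [Fact p.Prime] (h2 : p ≠ 2) {x ε δ : ℤ}
    (hx : ¬ (p : ℤ) ∣ x) (hε : ε = 1 ∨ ε = -1) (hδ : δ = 1 ∨ δ = -1)
    (h : ((x * ε : ℤ) : ZMod p) = ((x * δ : ℤ) : ZMod p)) : ε = δ := by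
  have hx0 : (x : ZMod p) ≠ 0 := by rwa [Ne, ZMod.intCast_zmod_eq_zero_iff_dvd]
  have h20 : (2 : ZMod p) ≠ 0 := two_ne_zero_of_charP (p := p) h2
  push_cast at h
  have h := mul_left_cancel₀ hx0 h
  rcases hε with rfl | rfl <;> rcases hδ with rfl | rfl <;> push_cast at h
  · rfl
  · exact absurd (by linear_combination h) h20
  · exact absurd (by linear_combination -h) h20
  · rfl

/-- The first sum alone suffices: outside the excluded case the coefficient of the sign is a power
of N times 1, b or 2m, hence prime to p. -/
theorem sign_unique_of_sumCongruences {b m : ℤ} {p : ℕ} [hp : Fact p.Prime] (h2 : p ≠ 2)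
    (hb : ¬ (p : ℤ) ∣ b) (hm : ¬ (p : ℤ) ∣ m) (hD : ¬ (p : ℤ) ∣ b ^ 2 + 4 * m ^ 2) {δ ε : ℤ}
    (hδ : δ = 1 ∨ δ = -1) (hε : ε = 1 ∨ ε = -1) (h1 : SumCongruences b m p δ)
    (h1' : SumCongruences b m p ε)
    (hne : ¬ (p % 4 = 1 ∧ legendreSym p (b ^ 2 + 4 * m ^ 2) = -1)) : ε = δ := by
  have hpr : Prime (p : ℤ) := Nat.prime_iff_prime_int.1 hp.out
  have hDn : ∀ n, ¬ (p : ℤ) ∣ (b ^ 2 + 4 * m ^ 2) ^ n := fun n h => hD (hpr.dvd_of_dvd_pow h)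
  have hmul : ∀ {x y : ℤ}, ¬ (p : ℤ) ∣ x → ¬ (p : ℤ) ∣ y → ¬ (p : ℤ) ∣ x * y := fun hx hy h =>
    (hpr.dvd_or_dvd h).elim hx hy
  have hl : legendreSym p (b ^ 2 + 4 * m ^ 2) = 1 ∨ legendreSym p (b ^ 2 + 4 * m ^ 2) = -1 :=
    legendreSym.eq_one_or_neg_one p (by rwa [Ne, ZMod.intCast_zmod_eq_zero_iff_dvd])
  have h2' : ¬ (p : ℤ) ∣ 2 := fun h =>
    h2 ((Nat.prime_dvd_prime_iff_eq hp.out Nat.prime_two).1 (by exact_mod_cast h))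
  rcases mod_four_of_prime h2 with h4 | h4 <;> rcases hl with hl | hl
  · refine eq_of_intCast_mul_eq h2 (hDn ((p - 1) / 4)) hε hδ ?_
    rw [mul_comm, mul_comm _ δ, ← (h1.1 h4 hl).1, ← (h1'.1 h4 hl).1]
  · exact absurd ⟨h4, hl⟩ hne
  · refine eq_of_intCast_mul_eq h2 (hmul hb (hDn ((p - 3) / 4))) hε hδ ?_
    rw [mul_right_comm, mul_right_comm _ _ δ, ← (h1.2.1 h4 hl).1, ← (h1'.2.1 h4 hl).1]
  · refine eq_of_intCast_mul_eq h2 (hmul (hmul h2' hm) (hDn ((p - 3) / 4))) hε hδ ?_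
    rw [mul_right_comm, mul_right_comm _ _ δ, ← (h1.2.2.2 h4 hl).1, ← (h1'.2.2.2 h4 hl).1]

/-! ### Primary Gaussian integers -/

/-- A Gaussian integer is primary if it is congruent to `1` modulo `2 + 2i`. -/
def IsPrimary (z : GaussianInt) : Prop := (⟨2, 2⟩ : GaussianInt) ∣ z - 1

theorem dvd_mk_of_four_dvd {x y : ℤ} (h1 : 4 ∣ x + y) (h2 : 4 ∣ y - x) :
    (⟨2, 2⟩ : GaussianInt) ∣ ⟨x, y⟩ := by
  obtain ⟨c, hc⟩ := h1
  obtain ⟨d, hd⟩ := h2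
  -- The coordinates of (2+2i)(c+di) are 2(c-d) and 2(c+d), with sum 4c and difference 4d.
  refine ⟨⟨c, d⟩, ?_⟩
  ext <;> simp <;> omega

theorem isPrimary_one : IsPrimary 1 := by simp [IsPrimary]

theorem IsPrimary.mul {z w : GaussianInt} (hz : IsPrimary z) (hw : IsPrimary w) :
    IsPrimary (z * w) := by
  have : z * w - 1 = (z - 1) * w + (w - 1) := by ring
  rw [IsPrimary, this]
  exact dvd_add (hz.mul_right _) hw

theorem IsPrimary.of_mul {z w : GaussianInt} (hz : IsPrimary z) (hw : IsPrimary (w * z)) :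
    IsPrimary w := by
  have : w - 1 = (w * z - 1) - w * (z - 1) := by ring
  rw [IsPrimary, this]
  exact dvd_sub hw (hz.mul_left _)

theorem IsPrimary.eq_one_of_isUnit {u : GaussianInt} (hu : IsUnit u) (h : IsPrimary u) :
    u = 1 := by
  obtain ⟨c, hc⟩ := h
  have hn := congrArg Zsqrtd.norm hc
  rw [Zsqrtd.norm_mul] at hn
  have e : Zsqrtd.norm (⟨2, 2⟩ : GaussianInt) = 8 := by decide
  rw [e] at hn
  rcases isUnit_iff.1 hu with rfl | rfl | rfl | rfl
  · rfl
  · have : Zsqrtd.norm (gI - 1) = 2 := by decide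
    omega
  · have : Zsqrtd.norm (-1 - 1 : GaussianInt) = 4 := by decide
    omega
  · have : Zsqrtd.norm (-gI - 1) = 2 := by decide
    omega

theorem IsPrimary.norm_mod_four {z : GaussianInt} (h : IsPrimary z) : z.norm % 4 = 1 := by
  obtain ⟨⟨c, d⟩, hc⟩ := h
  have h1 := congrArg Zsqrtd.re hc
  have h2 := congrArg Zsqrtd.im hc
  simp at h1 h2
  rw [norm_eq, show z.re = 2 * (c - d) + 1 by linarith, show z.im = 2 * (c + d) by linarith]
  ring_nf
  omega

/-! ### The quartic character and its Jacobi sum -/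

theorem sum_eval_eq_zero {K : Type*} [Field K] [Fintype K] (P : Polynomial K)
    (hP : P.natDegree < Fintype.card K - 1) : ∑ x : K, P.eval x = 0 := by
  simp_rw [Polynomial.eval_eq_sum_range]
  rw [Finset.sum_comm]
  refine Finset.sum_eq_zero fun i hi => ?_
  rw [← Finset.mul_sum, FiniteField.sum_pow_lt_card_sub_one, mul_zero]
  rw [Finset.mem_range] at hi
  omega

theorem mulChar_inv_eq_star {F : Type*} [Field F] (χ : MulChar F GaussianInt) :
    χ⁻¹ = χ.ringHomComp (starRingEnd GaussianInt) := by
  refine MulChar.ext fun a => ?_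
  rw [MulChar.inv_apply_eq_inv, MulChar.ringHomComp_apply, starRingEnd_apply]
  have hu : IsUnit (χ a) := a.isUnit.map χ
  apply hu.mul_left_cancel
  rw [Ring.mul_inverse_cancel _ hu, mul_star_eq_one hu]

theorem mulChar_pow_four {F : Type*} [Field F] (χ : MulChar F GaussianInt) : χ ^ 4 = 1 := by
  refine MulChar.ext fun a => ?_
  rw [MulChar.pow_apply_coe, MulChar.one_apply_coe]
  rcases isUnit_iff.1 (a.isUnit.map χ) with e | e | e | e <;> rw [e] <;> decide

/-- The classical absolute value of a Jacobi sum, obtained in ℂ and pulled back; character values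
are units, so inversion is conjugation. -/
theorem jacobiSum_mul_star {F : Type*} [Field F] [Fintype F] {χ ρ : MulChar F GaussianInt}
    (hF : ringChar F ≠ 0) (hχ : χ ≠ 1) (hρ : ρ ≠ 1) (hχρ : χ * ρ ≠ 1) :
    jacobiSum χ ρ * star (jacobiSum χ ρ) = (Fintype.card F : GaussianInt) := by
  have hinj := GaussianInt.toComplex_injective
  apply hinj
  have := jacobiSum_mul_jacobiSum_inv (F' := ℂ) (χ := χ.ringHomComp GaussianInt.toComplex)
    (φ := ρ.ringHomComp GaussianInt.toComplex)
    (by rw [ringChar.eq_zero]; exact hF.symm)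
    ((MulChar.ringHomComp_ne_one_iff hinj).mpr hχ)
    ((MulChar.ringHomComp_ne_one_iff hinj).mpr hρ)
    (by rw [← MulChar.ringHomComp_mul]; exact (MulChar.ringHomComp_ne_one_iff hinj).mpr hχρ)
  rw [MulChar.ringHomComp_inv, MulChar.ringHomComp_inv, jacobiSum_ringHomComp,
    jacobiSum_ringHomComp, mulChar_inv_eq_star, mulChar_inv_eq_star, jacobiSum_ringHomComp,
    starRingEnd_apply] at this
  rw [map_mul, this, map_natCast]

theorem dvd_unit_sub_one {u : GaussianInt} (hu : IsUnit u) : (1 + gI) ∣ u - 1 := by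
  rcases isUnit_iff.1 hu with rfl | rfl | rfl | rfl
  · simp
  · exact ⟨gI, by decide⟩
  · exact ⟨gI - 1, by decide⟩
  · exact ⟨-1, by decide⟩

theorem dvd_unit_sq_sub_one {u : GaussianInt} (hu : IsUnit u) : (2 : GaussianInt) ∣ u ^ 2 - 1 := by
  rcases isUnit_iff.1 hu with rfl | rfl | rfl | rfl
  · simp
  · exact ⟨-1, by decide⟩
  · simp
  · exact ⟨-1, by decide⟩

section Character

variable {q : ℕ} [hq : Fact q.Prime]

theorem exists_hom_zmod (h4 : q % 4 = 1) {π : GaussianInt} (hπ : π.norm = q) :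
    ∃ ψ : GaussianInt →+* ZMod q, ∀ z, ψ z = 0 → π ∣ z := by
  obtain ⟨ψ, hψ⟩ : ∃ ψ : GaussianInt →+* ZMod q, ψ π = 0 := by
    obtain ⟨r, hr⟩ := (ZMod.exists_sq_eq_neg_one_iff (p := q)).2 (by omega)
    let ψ₀ : GaussianInt →+* ZMod q := Zsqrtd.lift ⟨r, by rw [← hr]; simp⟩
    have h0 := hom_mul_star ψ₀ π
    rw [hπ, Int.cast_natCast, ZMod.natCast_self] at h0
    rcases mul_eq_zero.1 h0 with h | h
    · exact ⟨ψ₀, h⟩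
    -- If the chosen root of -1 kills the conjugate of `π` instead, the other root is the right one.
    · exact ⟨ψ₀.comp (starRingEnd GaussianInt), h⟩
  refine ⟨ψ, fun z hz => ?_⟩
  have hmax : (Ideal.span {π}).IsMaximal :=
    PrincipalIdealRing.isMaximal_of_irreducible (irreducible_of_norm_prime hq.out hπ)
  have hle : Ideal.span {π} ≤ RingHom.ker ψ := by
    rw [Ideal.span_singleton_le_iff_mem]; exact hψ
  rw [← Ideal.mem_span_singleton, hmax.eq_of_le (RingHom.ker_ne_top ψ) hle]
  exact hz

theorem exists_quartic_char (h4 : q % 4 = 1) (ψ : GaussianInt →+* ZMod q) :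
    ∃ χ : MulChar (ZMod q) GaussianInt, ∀ t, ψ (χ t) = t ^ ((q - 1) / 4) := by
  classical
  have hq1 := hq.out.one_lt
  have h2 : (2 : ZMod q) ≠ 0 := two_ne_zero_of_charP (p := q) (by omega)
  have hex : ∀ t : ZMod q, ∃ u : GaussianInt, t ≠ 0 → IsUnit u ∧ ψ u = t ^ ((q - 1) / 4) := by
    intro t
    by_cases ht : t = 0
    · exact ⟨0, fun h => absurd ht h⟩
    · obtain ⟨u, hu⟩ := exists_unit_of_pow_four ψ (x := t ^ ((q - 1) / 4)) (by
        rw [← pow_mul, show (q - 1) / 4 * 4 = q - 1 by omega, ZMod.pow_card_sub_one_eq_one ht])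
      exact ⟨u, fun _ => hu⟩
  choose c hc using hex
  refine ⟨{ toFun := fun t => if t = 0 then 0 else c t
            map_one' := ?_
            map_mul' := ?_
            map_nonunit' := ?_ }, ?_⟩
  · rw [if_neg one_ne_zero]
    exact hom_injOn_units ψ h2 (hc 1 one_ne_zero).1 isUnit_one
      (by rw [(hc 1 one_ne_zero).2, map_one, one_pow])
  · intro s t
    by_cases hs : s = 0
    · simp [hs]
    by_cases ht : t = 0
    · simp [ht]
    have hst := mul_ne_zero hs ht
    simp only [hs, ht, hst, if_false]
    exact hom_injOn_units ψ h2 (hc _ hst).1 ((hc s hs).1.mul (hc t ht).1)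
      (by rw [(hc _ hst).2, map_mul, (hc s hs).2, (hc t ht).2, mul_pow])
  · intro t ht
    rw [isUnit_iff_ne_zero, not_not] at ht
    simp [ht]
  · intro t
    by_cases ht : t = 0
    · have : (q - 1) / 4 ≠ 0 := by omega
      simp [ht, this]
    · simp [ht, (hc t ht).2]

variable {χ : MulChar (ZMod q) GaussianInt} {ψ : GaussianInt →+* ZMod q}

/-- Any nonsquare works, by Euler's criterion. This witness makes the order of χ exactly 4, also
after passing to characteristic p ≠ 2. -/
theorem exists_sq_eq_neg_one_of_quartic_char (h4 : q % 4 = 1)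
    (hχ : ∀ t, ψ (χ t) = t ^ ((q - 1) / 4)) : ∃ t, χ t ^ 2 = -1 := by
  obtain ⟨t, ht⟩ := FiniteField.exists_nonsquare (F := ZMod q)
    (by rw [ZMod.ringChar_zmod_n]; omega)
  have ht0 : t ≠ 0 := by rintro rfl; exact ht (IsSquare.zero)
  refine ⟨t, ?_⟩
  have hne : ψ (χ t) ^ 2 ≠ 1 := by
    rw [hχ, ← pow_mul, show (q - 1) / 4 * 2 = q / 2 by omega]
    exact fun h => ht ((ZMod.euler_criterion q ht0).2 h)
  rcases isUnit_iff.1 ((isUnit_iff_ne_zero.2 ht0).map χ) with e | e | e | e <;> rw [e] at hne ⊢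
  · simp at hne
  · decide
  · simp at hne
  · decide

theorem mulChar_pow_ne_one {R : Type*} [CommRing R] [Nontrivial R] (h2 : (2 : R) ≠ 0)
    {χ : MulChar (ZMod q) R}
    {t : ZMod q} (ht : χ t ^ 2 = -1) : χ ≠ 1 ∧ χ ^ 2 ≠ 1 ∧ χ ^ 3 ≠ 1 := by
  have ht0 : IsUnit t := by
    by_contra h
    rw [χ.map_nonunit h] at ht
    simp at ht
  have h11 : (-1 : R) ≠ 1 := fun h => h2 (by linear_combination -h)
  have h1 : (1 : MulChar (ZMod q) R) t = 1 := MulChar.one_apply ht0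
  refine ⟨fun h => h11 ?_, fun h => h11 ?_, fun h => h11 ?_⟩
  · rw [← ht, h, h1, one_pow]
  · rw [← ht, ← MulChar.pow_apply' _ two_ne_zero, h, h1]
  · have e : χ t ^ 3 = 1 := by rw [← MulChar.pow_apply' _ three_ne_zero, h, h1]
    linear_combination (χ t ^ 3 + 1) * e - (χ t ^ 4 - χ t ^ 2 + 1) * ht

/-- Expand ∑ (χ(t) - 1)(χ²(1-t) - 1): the linear terms sum to 0. Each term is divisible by (1+i)·2,
and vanishes at t = 0 and t = 1. -/
theorem dvd_jacobiSum_add_card (h1 : χ ≠ 1) (h2 : χ ^ 2 ≠ 1) :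
    (⟨2, 2⟩ : GaussianInt) ∣ jacobiSum χ (χ ^ 2) + q := by
  have e : jacobiSum χ (χ ^ 2) + q = ∑ t, (χ t - 1) * ((χ ^ 2) (1 - t) - 1) := by
    have e1 : ∑ t, χ t = 0 := MulChar.sum_eq_zero_of_ne_one h1
    have e2 : ∑ t, (χ ^ 2) (1 - t) = 0 := by
      rw [← MulChar.sum_eq_zero_of_ne_one h2, ← (Equiv.subLeft (1 : ZMod q)).sum_comp]
      simp
    have e3 : ∀ t, (χ t - 1) * ((χ ^ 2) (1 - t) - 1) =
        χ t * (χ ^ 2) (1 - t) - χ t - (χ ^ 2) (1 - t) + 1 := fun t => by ring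
    simp_rw [e3]
    rw [Finset.sum_add_distrib, Finset.sum_sub_distrib, Finset.sum_sub_distrib, e1, e2, jacobiSum]
    simp
  rw [e]
  refine Finset.dvd_sum fun t _ => ?_
  rcases eq_or_ne t 0 with rfl | ht
  · simp
  rcases eq_or_ne t 1 with rfl | ht1
  · simp
  have hs : (1 - t : ZMod q) ≠ 0 := sub_ne_zero.2 ht1.symm
  rw [MulChar.pow_apply' _ two_ne_zero, show (⟨2, 2⟩ : GaussianInt) = (1 + gI) * 2 by decide]
  exact mul_dvd_mul (dvd_unit_sub_one ((isUnit_iff_ne_zero.2 ht).map χ))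
    (dvd_unit_sq_sub_one ((isUnit_iff_ne_zero.2 hs).map χ))

/-- The image is a sum over `ZMod q` of a polynomial of degree at most 3(q-1)/4 < q-1. So π, rather
than π̄, divides the Jacobi sum. -/
theorem hom_jacobiSum_eq_zero (h4 : q % 4 = 1) (hχ : ∀ t, ψ (χ t) = t ^ ((q - 1) / 4)) :
    ψ (jacobiSum χ (χ ^ 2)) = 0 := by
  have hq1 := hq.out.one_lt
  let P : Polynomial (ZMod q) :=
    Polynomial.X ^ ((q - 1) / 4) * ((1 - Polynomial.X) ^ ((q - 1) / 4)) ^ 2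
  have hdeg : (1 - Polynomial.X : Polynomial (ZMod q)).natDegree ≤ 1 :=
    (Polynomial.natDegree_sub_le _ _).trans (by simp)
  have hP : P.natDegree < Fintype.card (ZMod q) - 1 := by
    rw [ZMod.card]
    have h1 : P.natDegree ≤ (q - 1) / 4 + 2 * ((q - 1) / 4 * 1) := by
      refine Polynomial.natDegree_mul_le.trans (Nat.add_le_add (by simp) ?_)
      refine Polynomial.natDegree_pow_le.trans (Nat.mul_le_mul_left _ ?_)
      exact Polynomial.natDegree_pow_le.trans (Nat.mul_le_mul_left _ hdeg)
    omega
  rw [← sum_eval_eq_zero P hP, jacobiSum, map_sum]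
  refine Finset.sum_congr rfl fun t _ => ?_
  rw [map_mul, MulChar.pow_apply' _ two_ne_zero, map_pow, hχ, hχ]
  simp [P]

/-- The Jacobi sum of the quartic residue character of a primary prime `π` and its square
is `-π`. -/
theorem jacobiSum_quartic_char (h4 : q % 4 = 1) {π : GaussianInt} (hπ : π.norm = q)
    (hprim : IsPrimary π) (hψ : ∀ z, ψ z = 0 → π ∣ z)
    (hχ : ∀ t, ψ (χ t) = t ^ ((q - 1) / 4)) : jacobiSum χ (χ ^ 2) = -π := by
  obtain ⟨t, ht⟩ := exists_sq_eq_neg_one_of_quartic_char h4 hχ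
  obtain ⟨h1, h2, h3⟩ := mulChar_pow_ne_one two_ne_zero ht
  obtain ⟨c, hc⟩ := hψ _ (hom_jacobiSum_eq_zero h4 hχ)
  have hq0 : (q : ℤ) ≠ 0 := by exact_mod_cast hq.out.ne_zero
  have hn : (jacobiSum χ (χ ^ 2)).norm = q := by
    have := jacobiSum_mul_star (χ := χ) (ρ := χ ^ 2)
      (by rw [ZMod.ringChar_zmod_n]; exact hq.out.ne_zero) h1 h2 (by rwa [← pow_succ'])
    rw [← Zsqrtd.norm_eq_mul_conj, ZMod.card] at this
    exact_mod_cast this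
  have hcu : IsUnit (-c) := by
    rw [IsUnit.neg_iff, ← Zsqrtd.norm_eq_one_iff' (by norm_num)]
    rw [hc, Zsqrtd.norm_mul, hπ] at hn
    exact mul_left_cancel₀ hq0 (by rw [hn, mul_one])
  -- The Jacobi sum is ≡ -q ≡ -1 modulo 2+2i, which pins down the unit `c`.
  have hp : IsPrimary (-c * π) := by
    have hd := dvd_jacobiSum_add_card h1 h2
    have h4' : (⟨2, 2⟩ : GaussianInt) ∣ ((q - 1 : ℤ) : GaussianInt) :=
      dvd_mk_of_four_dvd (x := (q : ℤ) - 1) (y := 0) (by omega) (by omega)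
    have e : -c * π - 1 = ((q - 1 : ℤ) : GaussianInt) - (jacobiSum χ (χ ^ 2) + q) := by
      rw [hc]; push_cast; ring
    rw [IsPrimary, e]
    exact dvd_sub h4' hd
  have := (hprim.of_mul hp).eq_one_of_isUnit hcu
  rw [hc, neg_eq_iff_eq_neg.1 this, mul_neg_one]

/-! ### Quartic Gauss sums -/

section GaussSum

variable {R : Type*} [Field R] {χ : MulChar (ZMod q) R} {ψ : AddChar (ZMod q) R}

theorem gaussSum_mul_gaussSum_inv (hψ : ψ.IsPrimitive) (h1 : χ ≠ 1) :
    gaussSum χ ψ * gaussSum χ⁻¹ ψ = χ (-1) * q := by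
  have e := gaussSum_mul_gaussSum_eq_card h1 hψ
  rw [ZMod.card] at e
  rw [← mul_gaussSum_inv_eq_gaussSum χ⁻¹ ψ, mul_left_comm, e, MulChar.inv_apply', inv_neg_one]

/-- Multiply G(χ)G(χ²) = J(χ,χ²)G(χ⁻¹) by G(χ) and use G(χ)G(χ⁻¹) = χ(-1)q; then square and use
G(χ²)² = q. -/
theorem gaussSum_quartic_pow_four (hq0 : (q : R) ≠ 0) (hψ : ψ.IsPrimitive) (hχ4 : χ ^ 4 = 1)
    (h1 : χ ≠ 1) (h2 : χ ^ 2 ≠ 1) (h3 : χ ^ 3 ≠ 1) :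
    gaussSum χ ψ ^ 4 = jacobiSum χ (χ ^ 2) ^ 2 * q := by
  have hinv : χ * χ ^ 2 = χ⁻¹ := by
    rw [eq_inv_iff_mul_eq_one, ← pow_succ', ← pow_succ, hχ4]
  have hinv2 : (χ ^ 2)⁻¹ = χ ^ 2 := by
    rw [inv_eq_iff_mul_eq_one, ← pow_add, hχ4]
  have hneg : χ (-1) ^ 2 = 1 := by rw [← map_pow, neg_one_sq, map_one]
  have e1 := jacobiSum_mul_nontrivial (χ := χ) (φ := χ ^ 2) (by rwa [← pow_succ']) ψ
  have e2 := gaussSum_mul_gaussSum_inv hψ h1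
  have e3 := gaussSum_mul_gaussSum_inv hψ h2
  rw [hinv2, MulChar.pow_apply' _ two_ne_zero, hneg] at e3
  rw [hinv] at e1
  have e4 : gaussSum χ ψ ^ 2 * gaussSum (χ ^ 2) ψ = χ (-1) * q * jacobiSum χ (χ ^ 2) := by
    linear_combination -gaussSum χ ψ * e1 + jacobiSum χ (χ ^ 2) * e2
  apply mul_right_cancel₀ hq0
  linear_combination -gaussSum χ ψ ^ 4 * e3 +
    (gaussSum χ ψ ^ 2 * gaussSum (χ ^ 2) ψ + χ (-1) * q * jacobiSum χ (χ ^ 2)) * e4 +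
    (q : R) ^ 2 * jacobiSum χ (χ ^ 2) ^ 2 * hneg

variable {p : ℕ} [Fact p.Prime] [CharP R p]

theorem gaussSum_quartic_frob (hpq : IsUnit (p : ZMod q)) (χ : MulChar (ZMod q) R)
    (ψ : AddChar (ZMod q) R) :
    gaussSum χ ψ ^ p = (χ ^ p)⁻¹ p * gaussSum (χ ^ p) ψ := by
  rw [gaussSum_frob, AddChar.pow_mulShift, ← hpq.unit_spec, gaussSum_mulShift_eq]

end GaussSum

end Character

/-! ### Quartic reciprocity -/

/-- Quartic reciprocity between a rational prime `p` and a primary Gaussian prime of degree one. -/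
theorem quarticJacobiSymbol_eq_char {q : ℕ} [hq : Fact q.Prime] {π : GaussianInt}
    (hπ : π.norm = q) (hprim : IsPrimary π) :
    ∃ χ : MulChar (ZMod q) GaussianInt, ∀ p : ℕ, p.Prime → p ≠ 2 → ¬ (p : ℤ) ∣ π.norm →
      quarticJacobiSymbol π p = χ (pstar p : ℤ) := by
  have h4 : q % 4 = 1 := by
    have := hprim.norm_mod_four
    rw [hπ] at this
    omega
  obtain ⟨ψ, hψ⟩ := exists_hom_zmod h4 hπ
  obtain ⟨χ, hχ⟩ := exists_quartic_char h4 ψ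
  refine ⟨χ, fun p hp hp2 hpπ => ?_⟩
  have : Fact p.Prime := ⟨hp⟩
  have hJ := jacobiSum_quartic_char h4 hπ hprim hψ hχ
  obtain ⟨t, ht⟩ := exists_sq_eq_neg_one_of_quartic_char h4 hχ
  obtain ⟨φ⟩ := exists_hom_algebraicClosure p
  have h2 : (2 : AlgebraicClosure (ZMod p)) ≠ 0 := two_ne_zero_of_charP (p := p) hp2
  have hq0 : (q : AlgebraicClosure (ZMod p)) ≠ 0 := by
    rw [Ne, CharP.cast_eq_zero_iff _ p]
    intro h
    exact hpπ (by rw [hπ]; exact_mod_cast h)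
  have hpq : IsUnit (p : ZMod q) := by
    rw [isUnit_iff_ne_zero, Ne, ZMod.natCast_eq_zero_iff]
    intro h
    have := (Nat.prime_dvd_prime_iff_eq hq.out hp).1 h
    exact hpπ (by rw [hπ, this])
  set χ' := χ.ringHomComp φ with hχ'
  have ht' : χ' t ^ 2 = -1 := by
    rw [hχ', MulChar.ringHomComp_apply, ← map_pow, ht, map_neg, map_one]
  have hχ4 : χ' ^ 4 = 1 := by
    rw [hχ', MulChar.ringHomComp_pow, mulChar_pow_four, MulChar.ringHomComp_one]
  obtain ⟨n1, n2, n3⟩ := mulChar_pow_ne_one h2 ht'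
  have : NeZero (q : AlgebraicClosure (ZMod p)) := ⟨hq0⟩
  obtain ⟨ζ, hζ⟩ := HasEnoughRootsOfUnity.exists_primitiveRoot (AlgebraicClosure (ZMod p)) q
  have hprimψ := AddChar.zmodChar_primitive_of_primitive_root q hζ
  set ψ' := AddChar.zmodChar q ((IsPrimitiveRoot.iff_def ζ q).mp hζ).left
  have hG4 := gaussSum_quartic_pow_four hq0 hprimψ hχ4 n1 n2 n3
  have hfrob := gaussSum_quartic_frob hpq χ' ψ'
  have hinv := gaussSum_mul_gaussSum_inv hprimψ n1
  have hG0 : gaussSum χ' ψ' ≠ 0 :=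
    gaussSum_ne_zero_of_nontrivial (by rwa [ZMod.card]) n1 hprimψ
  -- With q = ππ̄ and J = -π, the fourth power of the Gauss sum becomes π³π̄.
  have hqAB : (q : AlgebraicClosure (ZMod p)) = φ π * φ (star π) := by
    rw [hom_mul_star, hπ, Int.cast_natCast]
  rw [hχ', MulChar.ringHomComp_pow, jacobiSum_ringHomComp, hJ, map_neg, ← hχ', hqAB] at hG4
  rw [hqAB] at hinv
  have hA := hom_ne_zero φ (p := p) hpπ
  have hB := hom_star_ne_zero φ (p := p) hpπ
  have hXu : IsUnit (χ (pstar p : ℤ)) := by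
    apply IsUnit.map
    unfold pstar
    split_ifs <;> push_cast
    exacts [hpq, hpq.neg]
  refine hom_injOn_units φ h2 (isUnit_quarticJacobiSymbol hp2 hpπ) hXu ?_
  have hpX : χ' p ≠ 0 := (hpq.map χ').ne_zero
  rcases mod_four_of_prime hp2 with h | h
  · have hs := hom_symbol_mul_of_one φ h hpπ
    have hpow : χ' ^ p = χ' := by
      have e : χ' ^ (4 * ((p - 1) / 4) + 1) = χ' := by
        rw [pow_succ, pow_mul, hχ4, one_pow, one_mul]
      rwa [show 4 * ((p - 1) / 4) + 1 = p by omega] at e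
    rw [hpow, MulChar.inv_apply_eq_inv'] at hfrob
    -- Here Frobenius gives G^(p-1) = χ(p)⁻¹, and G^(p-1) is a power of G⁴.
    have hG : ((-φ π) ^ 2 * (φ π * φ (star π))) ^ ((p - 1) / 4) * χ' p = 1 := by
      rw [mul_eq_one_iff_eq_inv₀ hpX, ← hG4, ← pow_mul]
      apply mul_right_cancel₀ hG0
      rw [← pow_succ, show 4 * ((p - 1) / 4) + 1 = p by omega, hfrob]
    have hA4 : φ π ^ (4 * ((p - 1) / 4)) = 1 := by
      apply mul_right_cancel₀ hA
      rw [← pow_succ, show 4 * ((p - 1) / 4) + 1 = p by omega, hom_pow_char_of_one φ h, one_mul]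
    apply mul_right_cancel₀ (pow_ne_zero ((p - 1) / 4) hB)
    rw [hs, pstar, if_pos h]
    have e : φ (χ ((p : ℤ) : ZMod q)) = χ' p := by
      rw [hχ', MulChar.ringHomComp_apply, Int.cast_natCast]
    rw [e]
    have e5 : ((-φ π) ^ 2 * (φ π * φ (star π))) ^ ((p - 1) / 4) * φ π ^ ((p - 1) / 4) =
        φ π ^ (4 * ((p - 1) / 4)) * φ (star π) ^ ((p - 1) / 4) := by
      rw [pow_mul, ← mul_pow, ← mul_pow]; congr 1; ring
    rw [hA4, one_mul] at e5
    rw [← e5]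
    linear_combination -φ π ^ ((p - 1) / 4) * hG
  · have hs := hom_symbol_mul_of_three φ h hpπ
    have hpow : χ' ^ p = χ'⁻¹ := by
      rw [eq_inv_iff_mul_eq_one, ← pow_succ, show p + 1 = 4 * ((p + 1) / 4) by omega, pow_mul, hχ4,
        one_pow]
    rw [hpow, inv_inv] at hfrob
    have e : φ (χ ((-p : ℤ) : ZMod q)) = χ' p * χ' (-1) := by
      rw [hχ', MulChar.ringHomComp_apply, MulChar.ringHomComp_apply, ← map_mul, ← map_mul]
      push_cast
      rw [mul_neg_one]
    apply mul_right_cancel₀ (pow_ne_zero ((p + 1) / 4) hA)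
    rw [hs, pstar, if_neg (by omega), e]
    -- Now G^p = χ(p)G(χ⁻¹), so G^(p+1) = χ(p)χ(-1)q; the factor χ(-1) is what turns p into p* = -p.
    have hG : ((-φ π) ^ 2 * (φ π * φ (star π))) ^ ((p + 1) / 4) =
        χ' p * χ' (-1) * (φ π * φ (star π)) := by
      rw [← hG4, ← pow_mul, show 4 * ((p + 1) / 4) = p + 1 by omega, pow_succ, hfrob]
      linear_combination χ' p * hinv
    have hA4 : φ π ^ (4 * ((p + 1) / 4)) = φ π * φ (star π) := by
      rw [show 4 * ((p + 1) / 4) = p + 1 by omega, pow_succ, hom_pow_char_of_three φ h, mul_comm]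
    have e5 : ((-φ π) ^ 2 * (φ π * φ (star π))) ^ ((p + 1) / 4) * φ π ^ ((p + 1) / 4) =
        φ π ^ (4 * ((p + 1) / 4)) * φ (star π) ^ ((p + 1) / 4) := by
      rw [pow_mul, ← mul_pow, ← mul_pow]; congr 1; ring
    rw [hA4, hG] at e5
    apply mul_left_cancel₀ (mul_ne_zero hA hB)
    linear_combination -e5

/-! ### Periodicity of the symbol in p* -/

theorem pstar_mod_four {p : ℕ} (hp : p.Prime) (h2 : p ≠ 2) : pstar p % 4 = 1 := by
  have := hp.eq_two_or_odd
  unfold pstar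
  split_ifs <;> omega

theorem pstar_eq_or (p : ℕ) : pstar p = p ∨ pstar p = -p := by
  unfold pstar
  split_ifs <;> simp

theorem pstar_modEq {p p' : ℕ} (hp : p.Prime) (hp' : p'.Prime) (h2 : p ≠ 2) (h2' : p' ≠ 2) {M : ℤ}
    (hM : 4 ∣ M) (h : (p' : ℤ) ≡ p [ZMOD M] ∨ (p' : ℤ) ≡ -p [ZMOD M]) :
    pstar p ≡ pstar p' [ZMOD M] := by
  have hs := pstar_mod_four hp h2
  have hs' := pstar_mod_four hp' h2'
  have key : pstar p ≡ pstar p' [ZMOD M] ∨ pstar p ≡ -pstar p' [ZMOD M] := by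
    rcases h with h | h <;> have hn := h.neg <;> (try rw [neg_neg] at hn) <;>
      rcases pstar_eq_or p with e | e <;> rcases pstar_eq_or p' with e' | e' <;> rw [e, e'] <;>
      first
        | exact Or.inl h.symm
        | exact Or.inl hn.symm
        | exact Or.inr (by rw [neg_neg]; exact h.symm)
        | exact Or.inr h.symm
        | exact Or.inr hn.symm
  rcases key with h | h
  · exact h
  -- The sign -1 is impossible, as both numbers are 1 modulo 4.
  · have := h.of_dvd hM
    unfold Int.ModEq at this
    omega

/-- The symbol `(α/p)₄` depends only on the residue of `p*` modulo `M`. -/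
def SymbolPeriodic (M : ℤ) (α : GaussianInt) : Prop :=
  ∀ p p' : ℕ, p.Prime → p'.Prime → p ≠ 2 → p' ≠ 2 → ¬ (p : ℤ) ∣ α.norm → ¬ (p' : ℤ) ∣ α.norm →
    pstar p ≡ pstar p' [ZMOD M] → quarticJacobiSymbol α p = quarticJacobiSymbol α p'

theorem SymbolPeriodic.of_dvd {M M' : ℤ} {α : GaussianInt} (h : SymbolPeriodic M α)
    (hd : M ∣ M') : SymbolPeriodic M' α :=
  fun p p' h1 h2 h3 h4 h5 h6 h7 => h p p' h1 h2 h3 h4 h5 h6 (h7.of_dvd hd)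

theorem SymbolPeriodic.mul {M : ℤ} {α β : GaussianInt} (hα : SymbolPeriodic M α)
    (hβ : SymbolPeriodic M β) : SymbolPeriodic M (α * β) := by
  intro p p' hp hp' h2 h2' hd hd' h
  have : Fact p.Prime := ⟨hp⟩
  have : Fact p'.Prime := ⟨hp'⟩
  obtain ⟨a, b⟩ := not_dvd_norm_of_mul hd
  obtain ⟨a', b'⟩ := not_dvd_norm_of_mul hd'
  rw [quarticJacobiSymbol_mul h2 hd, quarticJacobiSymbol_mul h2' hd',
    hα p p' hp hp' h2 h2' a a' h, hβ p p' hp hp' h2 h2' b b' h]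

/-- When α/ᾱ is a unit the power formula is explicit. This covers integers (w = 1), units u (w = u²)
and (1+i)^k (w = i^k), where reciprocity for odd primes does not apply. -/
theorem quarticJacobiSymbol_of_eq_mul_star {α w : GaussianInt} (hw : IsUnit w)
    (hα : α = w * star α) {n : ℕ} (hn : 0 < n) (hwn : w ^ n = 1) {p : ℕ} [Fact p.Prime]
    (h2 : p ≠ 2) (hd : ¬ (p : ℤ) ∣ α.norm) :
    quarticJacobiSymbol α p = w ^ ((pstar p - 1) / 4 % n).toNat := by
  obtain ⟨φ⟩ := exists_hom_algebraicClosure p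
  refine quarticJacobiSymbol_eq_of_hom φ h2 hd (hw.pow _) ?_
  have hw0 : φ w ≠ 0 := (hw.map φ).ne_zero
  have e : φ α / φ (star α) = φ w := by
    rw [div_eq_iff (hom_star_ne_zero φ (p := p) hd), ← map_mul, ← hα]
  rw [e, map_pow, ← zpow_natCast, Int.toNat_of_nonneg (Int.emod_nonneg _ (by omega))]
  conv_rhs => rw [← Int.emod_add_mul_ediv ((pstar p - 1) / 4) n]
  rw [zpow_add₀ hw0, zpow_mul, zpow_natCast, ← map_pow, hwn, map_one, one_zpow, mul_one]

theorem symbolPeriodic_of_eq_mul_star {α w : GaussianInt} (hw : IsUnit w) (hα : α = w * star α)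
    {n : ℕ} (hn : 0 < n) (hwn : w ^ n = 1) : SymbolPeriodic (4 * n) α := by
  intro p p' hp hp' h2 h2' hd hd' h
  have : Fact p.Prime := ⟨hp⟩
  have : Fact p'.Prime := ⟨hp'⟩
  rw [quarticJacobiSymbol_of_eq_mul_star hw hα hn hwn h2 hd,
    quarticJacobiSymbol_of_eq_mul_star hw hα hn hwn h2' hd']
  have e : (pstar p - 1) / 4 ≡ (pstar p' - 1) / 4 [ZMOD n] := by
    have hs := pstar_mod_four hp h2
    have hs' := pstar_mod_four hp' h2'
    obtain ⟨c, hc⟩ := h.dvd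
    refine Int.modEq_iff_dvd.2 ⟨c, ?_⟩
    rw [mul_assoc] at hc
    omega
  rw [e]

theorem symbolPeriodic_intCast (n : ℤ) : SymbolPeriodic 4 (n : GaussianInt) := by
  simpa using symbolPeriodic_of_eq_mul_star (α := (n : GaussianInt)) isUnit_one (by simp)
    one_pos (one_pow 1)

theorem symbolPeriodic_unit {u : GaussianInt} (hu : IsUnit u) : SymbolPeriodic 8 u := by
  have := symbolPeriodic_of_eq_mul_star (hu.pow 2)
    (by rw [sq, mul_assoc, mul_star_eq_one hu, mul_one]) two_pos (w := u ^ 2) (by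
      rcases isUnit_iff.1 hu with rfl | rfl | rfl | rfl <;> decide)
  simpa using this

theorem symbolPeriodic_one_add_gI_pow (k : ℕ) : SymbolPeriodic 16 ((1 + gI) ^ k) := by
  have := symbolPeriodic_of_eq_mul_star (α := (1 + gI) ^ k) (isUnit_gI.pow k)
    (by rw [star_pow, ← mul_pow]; congr 1) four_pos (by
      rw [← pow_mul, mul_comm, pow_mul, show gI ^ 4 = 1 by decide, one_pow])
  simpa using this

theorem exists_unit_mul_isPrimary {z : GaussianInt} (hz : z.norm % 2 = 1) :
    ∃ u, IsUnit u ∧ IsPrimary (u * z) := by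
  obtain ⟨x, y⟩ := z
  rw [norm_eq] at hz
  simp only at hz
  have hxy : (x + y) % 2 = 1 := by
    have : (x ^ 2 + y ^ 2) % 2 = (x + y) % 2 := by
      rcases Int.even_or_odd' x with ⟨c, rfl | rfl⟩ <;>
        rcases Int.even_or_odd' y with ⟨d, rfl | rfl⟩ <;> ring_nf <;> omega
    omega
  have key : ∀ u : GaussianInt, ∀ x' y' : ℤ, IsUnit u → u * ⟨x, y⟩ = ⟨x', y'⟩ →
      (x' + y') % 4 = 1 → y' % 2 = 0 → ∃ u, IsUnit u ∧ IsPrimary (u * ⟨x, y⟩) := by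
    intro u x' y' hu he h1 h2
    refine ⟨u, hu, ?_⟩
    rw [he, IsPrimary, show (⟨x', y'⟩ - 1 : GaussianInt) = ⟨x' - 1, y'⟩ by ext <;> simp]
    exact dvd_mk_of_four_dvd (by omega) (by omega)
  -- A power of i makes the imaginary part even and the coordinate sum 1 modulo 4.
  rcases (by omega : (x + y) % 4 = 1 ∧ y % 2 = 0 ∨ (x + y) % 4 = 3 ∧ y % 2 = 0 ∨
      (x - y) % 4 = 1 ∧ y % 2 = 1 ∨ (x - y) % 4 = 3 ∧ y % 2 = 1) with
    ⟨h1, h2⟩ | ⟨h1, h2⟩ | ⟨h1, h2⟩ | ⟨h1, h2⟩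
  · exact key 1 x y isUnit_one (by simp) h1 h2
  · exact key (-1) (-x) (-y) isUnit_one.neg (by ext <;> simp) (by omega) (by omega)
  · exact key gI (-y) x isUnit_gI (by ext <;> simp [gI]) (by omega) (by omega)
  · exact key (-gI) y (-x) isUnit_gI.neg (by ext <;> simp [gI]) (by omega) (by omega)

theorem exists_prime_of_dvd_natCast {π : GaussianInt} (hπ : Prime π) {n : ℕ} (hn : n ≠ 0)
    (hd : π ∣ (n : GaussianInt)) : ∃ q : ℕ, q.Prime ∧ π ∣ (q : GaussianInt) := by
  induction n using induction_on_primes with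
  | zero => exact absurd rfl hn
  | one => exact absurd (isUnit_of_dvd_one (by simpa using hd)) hπ.not_isUnit
  | prime_mul q a hq ih =>
    rw [Nat.cast_mul] at hd
    rcases hπ.dvd_or_dvd hd with h | h
    · exact ⟨q, hq, h⟩
    · exact ih (right_ne_zero_of_mul hn) h

theorem prime_norm_eq_or_associated {π : GaussianInt} (hπ : Prime π) :
    ∃ q : ℕ, q.Prime ∧ (π.norm = q ∨ ∃ u, IsUnit u ∧ π = u * q) := by
  have hn0 : π.norm.natAbs ≠ 0 := by
    rw [Int.natAbs_ne_zero, Ne, GaussianInt.norm_eq_zero]; exact hπ.ne_zero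
  obtain ⟨q, hq, c, hc⟩ := exists_prime_of_dvd_natCast hπ hn0 ⟨star π, by
    rw [← Zsqrtd.norm_eq_mul_conj, GaussianInt.natCast_natAbs_norm]⟩
  refine ⟨q, hq, ?_⟩
  have hn := congrArg (fun z : GaussianInt => z.norm.natAbs) hc
  simp only [Zsqrtd.norm_mul, Int.natAbs_mul, Zsqrtd.norm_natCast, Int.natAbs_natCast] at hn
  obtain ⟨i, hi, he⟩ := (Nat.dvd_prime_pow hq (m := 2)).1 ⟨_, (sq q).trans hn⟩
  interval_cases i
  · exact absurd (Zsqrtd.norm_eq_one_iff.1 (by simpa using he)) hπ.not_isUnit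
  · left
    rw [← GaussianInt.abs_natCast_norm, he, pow_one]
  · right
    have hcu : IsUnit c := by
      rw [← Zsqrtd.norm_eq_one_iff]
      rw [he, sq] at hn
      exact Nat.eq_of_mul_eq_mul_left (Nat.mul_pos hq.pos hq.pos) (by rw [← hn, mul_one])
    refine ⟨star c, ?_, ?_⟩
    · exact IsUnit.of_mul_eq_one c (by rw [mul_comm, mul_star_eq_one hcu])
    · rw [hc, mul_left_comm, mul_comm (star c), mul_star_eq_one hcu, mul_one]

/-- `α` is a unit times a power of `1 + i` times a primary number whose symbols are periodic. -/
def HasPeriodicPrimaryPart (α : GaussianInt) : Prop :=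
  ∃ (u : GaussianInt) (k : ℕ) (γ : GaussianInt), IsUnit u ∧ IsPrimary γ ∧
    SymbolPeriodic (4 * γ.norm) γ ∧ α = u * (1 + gI) ^ k * γ

theorem symbolPeriodic_one (M : ℤ) : SymbolPeriodic (4 * M) 1 := by
  have := (symbolPeriodic_intCast 1).of_dvd (Dvd.intro M rfl : (4 : ℤ) ∣ 4 * M)
  simpa using this

theorem hasPeriodicPrimaryPart_of_isUnit {u : GaussianInt} (hu : IsUnit u) :
    HasPeriodicPrimaryPart u :=
  ⟨u, 0, 1, hu, isPrimary_one, symbolPeriodic_one _, by simp⟩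

theorem HasPeriodicPrimaryPart.mul {α β : GaussianInt} (hα : HasPeriodicPrimaryPart α)
    (hβ : HasPeriodicPrimaryPart β) : HasPeriodicPrimaryPart (α * β) := by
  obtain ⟨u, k, γ, hu, hγ, hp, rfl⟩ := hα
  obtain ⟨u', k', γ', hu', hγ', hp', rfl⟩ := hβ
  refine ⟨u * u', k + k', γ * γ', hu.mul hu', hγ.mul hγ', ?_, by ring⟩
  rw [Zsqrtd.norm_mul]
  exact (hp.of_dvd ⟨γ'.norm, by ring⟩).mul (hp'.of_dvd ⟨γ.norm, by ring⟩)

theorem hasPeriodicPrimaryPart_of_primary_mul {u z : GaussianInt} (hu : IsUnit u)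
    (hz : IsPrimary (u * z)) (h : SymbolPeriodic (4 * z.norm) (u * z)) :
    HasPeriodicPrimaryPart z := by
  have hn : (u * z).norm = z.norm := by
    rw [Zsqrtd.norm_mul, (Zsqrtd.norm_eq_one_iff' (by norm_num) u).2 hu, one_mul]
  refine ⟨star u, 0, u * z, ?_, hz, by rwa [hn], ?_⟩
  · exact IsUnit.of_mul_eq_one u (by rw [mul_comm, mul_star_eq_one hu])
  · rw [pow_zero, mul_one, ← mul_assoc, mul_comm (star u), mul_star_eq_one hu, one_mul]

theorem hasPeriodicPrimaryPart_natCast_prime {q : ℕ} (hq : q.Prime) :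
    HasPeriodicPrimaryPart (q : GaussianInt) := by
  rcases hq.eq_two_or_odd with rfl | hodd
  · exact ⟨-gI, 2, 1, isUnit_gI.neg, isPrimary_one, symbolPeriodic_one _, by decide⟩
  · obtain ⟨s, hs, hprim⟩ : ∃ s : ℤ, IsUnit (s : GaussianInt) ∧
        IsPrimary ((s : GaussianInt) * (q : GaussianInt)) := by
      rcases (by omega : q % 4 = 1 ∨ q % 4 = 3) with h | h
      · refine ⟨1, by simp, ?_⟩
        have := dvd_mk_of_four_dvd (x := (q : ℤ) - 1) (y := 0) (by omega) (by omega)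
        rw [IsPrimary]
        convert this using 1
        ext <;> simp
      · refine ⟨-1, by simp, ?_⟩
        have := dvd_mk_of_four_dvd (x := -(q : ℤ) - 1) (y := 0) (by omega) (by omega)
        rw [IsPrimary]
        convert this using 1
        ext <;> simp
    refine hasPeriodicPrimaryPart_of_primary_mul hs hprim ?_
    have := (symbolPeriodic_intCast (s * q)).of_dvd
      (Dvd.intro (q : GaussianInt).norm rfl : (4 : ℤ) ∣ _)
    simpa using this

theorem hasPeriodicPrimaryPart_of_prime {π : GaussianInt} (hπ : Prime π) :
    HasPeriodicPrimaryPart π := by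
  obtain ⟨q, hq, hn | ⟨u, hu, rfl⟩⟩ := prime_norm_eq_or_associated hπ
  · rcases hq.eq_two_or_odd with rfl | hodd
    · obtain ⟨u, hu, he⟩ : ∃ u, IsUnit u ∧ π = u * (1 + gI) := by
        obtain ⟨x, y⟩ := π
        rw [norm_eq] at hn
        simp only at hn
        push_cast at hn
        have hx : x ≤ 1 := by nlinarith
        have hx' : -1 ≤ x := by nlinarith
        have hy : y ≤ 1 := by nlinarith
        have hy' : -1 ≤ y := by nlinarith
        interval_cases x <;> interval_cases y <;> try omega
        · exact ⟨-1, isUnit_one.neg, by decide⟩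
        · exact ⟨gI, isUnit_gI, by decide⟩
        · exact ⟨-gI, isUnit_gI.neg, by decide⟩
        · exact ⟨1, isUnit_one, by decide⟩
      exact ⟨u, 1, 1, hu, isPrimary_one, symbolPeriodic_one _, by rw [he]; ring⟩
    · obtain ⟨u, hu, hprim⟩ := exists_unit_mul_isPrimary (z := π) (by rw [hn]; omega)
      refine hasPeriodicPrimaryPart_of_primary_mul hu hprim ?_
      have hun : (u * π).norm = q := by
        rw [Zsqrtd.norm_mul, (Zsqrtd.norm_eq_one_iff' (by norm_num) u).2 hu, one_mul, hn]
      have : Fact q.Prime := ⟨hq⟩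
      obtain ⟨χ, hχ⟩ := quarticJacobiSymbol_eq_char hun hprim
      intro p p' hp hp' h2 h2' hd hd' h
      rw [hχ p hp h2 hd, hχ p' hp' h2' hd', hn] at *
      rw [(ZMod.intCast_eq_intCast_iff _ _ q).2 (h.of_dvd (Dvd.intro_left 4 rfl))]
  · exact (hasPeriodicPrimaryPart_of_isUnit hu).mul (hasPeriodicPrimaryPart_natCast_prime hq)

theorem hasPeriodicPrimaryPart {α : GaussianInt} (hα : α ≠ 0) : HasPeriodicPrimaryPart α := by
  induction α using UniqueFactorizationMonoid.induction_on_prime with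
  | h₁ => exact absurd rfl hα
  | h₂ x hx => exact hasPeriodicPrimaryPart_of_isUnit hx
  | h₃ a π ha hπ ih => exact (hasPeriodicPrimaryPart_of_prime hπ).mul (ih ha)

/-- In the decomposition of a primary number the power of 1+i is trivial because the norm is odd,
and the unit is trivial because 1 is the only primary unit. -/
theorem symbolPeriodic_of_isPrimary {α : GaussianInt} (hα : IsPrimary α) :
    SymbolPeriodic (4 * α.norm) α := by
  have hn := hα.norm_mod_four
  obtain ⟨u, k, γ, hu, hγ, hp, e⟩ := hasPeriodicPrimaryPart (α := α) (by
    rintro rfl; simp at hn)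
  have hk : k = 0 := by
    by_contra hk
    obtain ⟨j, rfl⟩ := Nat.exists_eq_succ_of_ne_zero hk
    have h2 : Zsqrtd.norm (1 + gI) = 2 := by decide
    rw [e, pow_succ, show u * ((1 + gI) ^ j * (1 + gI)) * γ = (1 + gI) * (u * (1 + gI) ^ j * γ) by
      ring, Zsqrtd.norm_mul, h2] at hn
    omega
  rw [hk, pow_zero, mul_one] at e
  have : u = 1 := (hγ.of_mul (e ▸ hα)).eq_one_of_isUnit hu
  rw [this, one_mul] at e
  rwa [e]

/-- The unit costs modulus 8. A factor (1+i)^k with k ≥ 1 costs 16, which the factor 2^k of the norm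
absorbs. -/
theorem symbolPeriodic_eight_norm {β : GaussianInt} (hβ : β ≠ 0) :
    SymbolPeriodic (8 * β.norm) β := by
  obtain ⟨u, k, γ, hu, -, hp, rfl⟩ := hasPeriodicPrimaryPart hβ
  have hn : (u * (1 + gI) ^ k * γ).norm = 2 ^ k * γ.norm := by
    have h2 : Zsqrtd.norm (1 + gI) = 2 := by decide
    have hpow : ∀ k : ℕ, Zsqrtd.norm ((1 + gI) ^ k) = 2 ^ k := fun k => by
      induction k with
      | zero => simp
      | succ k ih => rw [pow_succ, Zsqrtd.norm_mul, ih, h2, pow_succ]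
    rw [Zsqrtd.norm_mul, Zsqrtd.norm_mul, (Zsqrtd.norm_eq_one_iff' (by norm_num) u).2 hu, hpow,
      one_mul]
  rw [hn]
  refine (((symbolPeriodic_unit hu).of_dvd ⟨2 ^ k * γ.norm, by ring⟩).mul ?_).mul
    (hp.of_dvd ⟨2 * 2 ^ k, by ring⟩)
  rcases k with - | k
  · rw [pow_zero, one_mul]
    exact (symbolPeriodic_one 1).of_dvd ⟨2 * γ.norm, by ring⟩
  · exact (symbolPeriodic_one_add_gI_pow _).of_dvd ⟨2 ^ k * γ.norm, by rw [pow_succ]; ring⟩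

theorem four_dvd_modulus (b m : ℤ) :
    4 ∣ (3 - (((-1 : ℤˣ) ^ b : ℤˣ) : ℤ)) * (b ^ 2 + 4 * m ^ 2) := by
  rcases Int.even_or_odd b with hb | hb
  · rw [hb.neg_one_zpow]
    obtain ⟨c, rfl⟩ := hb
    exact ⟨2 * (c ^ 2 + m ^ 2), by push_cast; ring⟩
  · rw [hb.neg_one_zpow]
    exact ⟨b ^ 2 + 4 * m ^ 2, by push_cast; ring⟩

/-- For odd b one of ±(b+2mi) is primary, giving modulus 4N. For b = 2c the number is 2(c+mi), and
8(c²+m²) = 2N. Integer factors only need modulus 4. -/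
theorem symbolPeriodic_mk {b m : ℤ} (hb0 : b ≠ 0) :
    SymbolPeriodic ((3 - (((-1 : ℤˣ) ^ b : ℤˣ) : ℤ)) * (b ^ 2 + 4 * m ^ 2)) ⟨b, 2 * m⟩ := by
  rcases Int.even_or_odd b with hb | hb
  · rw [hb.neg_one_zpow]
    obtain ⟨c, rfl⟩ := hb
    have h := symbolPeriodic_eight_norm (β := ⟨c, m⟩) (by
      intro h
      have := congrArg Zsqrtd.re h
      simp at this
      omega)
    have e : (⟨c + c, 2 * m⟩ : GaussianInt) = ((2 : ℤ) : GaussianInt) * ⟨c, m⟩ := by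
      ext <;> simp; ring
    rw [e]
    rw [norm_eq] at h
    exact ((symbolPeriodic_intCast 2).of_dvd ⟨2 * (c ^ 2 + m ^ 2), by push_cast; ring⟩).mul
      (h.of_dvd ⟨1, by push_cast; ring⟩)
  · rw [hb.neg_one_zpow]
    have hM : (3 - ((-1 : ℤˣ) : ℤ)) * (b ^ 2 + 4 * m ^ 2) = 4 * (b ^ 2 + 4 * m ^ 2) := by
      push_cast; ring
    rw [hM]
    obtain ⟨c, rfl⟩ := hb
    rcases Int.even_or_odd' (c + m) with ⟨d, hd | hd⟩
    · have hprim : IsPrimary ⟨2 * c + 1, 2 * m⟩ := by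
        rw [IsPrimary, show (⟨2 * c + 1, 2 * m⟩ - 1 : GaussianInt) = ⟨2 * c, 2 * m⟩ by
          ext <;> simp]
        exact dvd_mk_of_four_dvd (by omega) (by omega)
      have := symbolPeriodic_of_isPrimary hprim
      rwa [norm_mk] at this
    · have hprim : IsPrimary ⟨-(2 * c + 1), 2 * -m⟩ := by
        rw [IsPrimary, show (⟨-(2 * c + 1), 2 * -m⟩ - 1 : GaussianInt) =
          ⟨-(2 * c) - 2, 2 * -m⟩ by ext <;> simp; ring]
        exact dvd_mk_of_four_dvd (by omega) (by omega)
      have h := symbolPeriodic_of_isPrimary hprim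
      have e : (⟨2 * c + 1, 2 * m⟩ : GaussianInt) =
          ((-1 : ℤ) : GaussianInt) * ⟨-(2 * c + 1), 2 * -m⟩ := by
        ext <;> simp
      rw [e]
      rw [norm_mk, neg_sq, neg_sq] at h
      exact ((symbolPeriodic_intCast (-1)).of_dvd (Dvd.intro _ rfl)).mul h

/-! ### The sign δ and the theorem -/

open Classical in
/-- The sign `δ_p`: the symbol `(b + 2mi / p)₄` if that is `± 1`, and the symbol times `i`
otherwise. -/
noncomputable def quarticSign (b m : ℤ) (p : ℕ) : ℤ :=
  if quarticJacobiSymbol ⟨b, 2 * m⟩ p = 1 ∨ quarticJacobiSymbol ⟨b, 2 * m⟩ p = -gI then 1 else -1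

theorem quarticSign_eq_or (b m : ℤ) (p : ℕ) : quarticSign b m p = 1 ∨ quarticSign b m p = -1 := by
  unfold quarticSign
  split_ifs <;> simp

theorem quarticSign_of_symbol {b m : ℤ} {p : ℕ}
    (h : quarticJacobiSymbol ⟨b, 2 * m⟩ p = 1 ∨ quarticJacobiSymbol ⟨b, 2 * m⟩ p = -1) :
    (quarticSign b m p : GaussianInt) = quarticJacobiSymbol ⟨b, 2 * m⟩ p := by
  have h1 : ¬ ((-1 : GaussianInt) = 1 ∨ (-1 : GaussianInt) = -gI) := by decide
  rcases h with h | h <;> rw [quarticSign, h]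
  · simp
  · rw [if_neg h1]; simp

theorem quarticSign_of_symbol_mul {b m : ℤ} {p : ℕ}
    (h : quarticJacobiSymbol ⟨b, 2 * m⟩ p = gI ∨ quarticJacobiSymbol ⟨b, 2 * m⟩ p = -gI) :
    (quarticSign b m p : GaussianInt) = quarticJacobiSymbol ⟨b, 2 * m⟩ p * gI := by
  have h1 : ¬ (gI = 1 ∨ gI = -gI) := by decide
  rcases h with h | h <;> rw [quarticSign, h]
  · rw [if_neg h1, gI_mul_gI]; simp
  · rw [if_pos (Or.inr rfl), neg_mul, gI_mul_gI]; simp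

theorem not_dvd_factors {p : ℕ} {b m : ℤ} (h : ¬ (p : ℤ) ∣ b * m * (b ^ 2 + 4 * m ^ 2)) :
    ¬ (p : ℤ) ∣ b ∧ ¬ (p : ℤ) ∣ m ∧ ¬ (p : ℤ) ∣ b ^ 2 + 4 * m ^ 2 :=
  ⟨fun h' => h ((h'.mul_right _).mul_right _), fun h' => h ((h'.mul_left _).mul_right _),
    fun h' => h (h'.mul_left _)⟩

end QuarticSums

theorem theorem2p11 (b m : ℤ) :
    ∃ δ : ℕ → ℤ,
      (∀ (p : ℕ) [Fact p.Prime], p ≠ 2 → ¬ (p : ℤ) ∣ b * m * (b ^ 2 + 4 * m ^ 2) →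
        (δ p = 1 ∨ δ p = -1) ∧
        QuarticSums.SumCongruences b m p (δ p) ∧
        -- uniqueness of the sign, except where both sums vanish modulo `p`
        (¬ (p % 4 = 1 ∧ legendreSym p (b ^ 2 + 4 * m ^ 2) = -1) →
          ∀ ε : ℤ, (ε = 1 ∨ ε = -1) → QuarticSums.SumCongruences b m p ε → ε = δ p) ∧
        (legendreSym p (b ^ 2 + 4 * m ^ 2) = 1 →
          (δ p : GaussianInt) =
            QuarticSums.quarticJacobiSymbol (⟨b, 2 * m⟩ : GaussianInt) (p : GaussianInt)) ∧
        (legendreSym p (b ^ 2 + 4 * m ^ 2) = -1 →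
          (δ p : GaussianInt) =
            QuarticSums.quarticJacobiSymbol (⟨b, 2 * m⟩ : GaussianInt) (p : GaussianInt) *
              QuarticSums.gI)) ∧
      (∀ p p' : ℕ, p.Prime → p'.Prime → p ≠ 2 → p' ≠ 2 →
        ¬ (p : ℤ) ∣ b * m * (b ^ 2 + 4 * m ^ 2) →
        ¬ (p' : ℤ) ∣ b * m * (b ^ 2 + 4 * m ^ 2) →
        ((p' : ℤ) ≡ (p : ℤ) [ZMOD (3 - (((-1 : ℤˣ) ^ b : ℤˣ) : ℤ)) * (b ^ 2 + 4 * m ^ 2)] ∨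
          (p' : ℤ) ≡ -(p : ℤ) [ZMOD (3 - (((-1 : ℤˣ) ^ b : ℤˣ) : ℤ)) * (b ^ 2 + 4 * m ^ 2)]) →
        δ p = δ p') := by
  refine ⟨QuarticSums.quarticSign b m, fun p _ h2 hd => ?_, fun p p' hp hp' h2 h2' hd hd' h => ?_⟩
  · obtain ⟨hb, hm, hD⟩ := QuarticSums.not_dvd_factors hd
    have hN : ¬ (p : ℤ) ∣ Zsqrtd.norm (⟨b, 2 * m⟩ : GaussianInt) := by rwa [QuarticSums.norm_mk]
    have hleg := QuarticSums.symbol_cases_of_legendreSym h2 hN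
    rw [QuarticSums.norm_mk] at hleg
    have h1 := fun hl => QuarticSums.quarticSign_of_symbol (hleg.1 hl)
    have h1' := fun hl => QuarticSums.quarticSign_of_symbol_mul (hleg.2 hl)
    have hδ := QuarticSums.quarticSign_eq_or b m p
    have hS := QuarticSums.sumCongruences_of_symbol h2 hb hm hD h1 h1'
    exact ⟨hδ, hS, fun hne ε hε hε' =>
      QuarticSums.sign_unique_of_sumCongruences h2 hb hm hD hδ hε hS hε' hne, h1, h1'⟩
  · obtain ⟨-, -, hD⟩ := QuarticSums.not_dvd_factors hd
    obtain ⟨-, -, hD'⟩ := QuarticSums.not_dvd_factors hd'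
    have hb0 : b ≠ 0 := by rintro rfl; simp at hd
    rw [← QuarticSums.norm_mk] at hD hD'
    have := QuarticSums.symbolPeriodic_mk (m := m) hb0 p p' hp hp' h2 h2' hD hD'
      (QuarticSums.pstar_modEq hp hp' h2 h2' (QuarticSums.four_dvd_modulus b m) h)
    rw [QuarticSums.quarticSign, QuarticSums.quarticSign, this]
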